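/- Let $p$ be a prime and $n\ge 0$. For $0\le i\le n-1$ let $\sigma_i\in\operatorname{Sym}(\mathbb F_p^n)$ be the permutation that sends $(\lambda_0,\dots,\lambda_{n-1})$ to $(\lambda_0,\dots,\lambda_{i-1},\lambda_i+1,\lambda_{i+1},\dots,\lambda_{n-1})$ if $\lambda_k=0$ for all $k<i$, and fixes it otherwise. Let $P_n=\langle\sigma_0,\dots,\sigma_{n-1}\rangle$, a copy of the $n$-fold iterated wreath product $C_p\wr\cdots\wr C_p$ and a Sylow $p$-subgroup of $\operatorname{Sym}(\mathbb F_p^n)\cong S_{p^n}$. For $0\le j\le n$ view $P_j=\langle\sigma_0,\dots,\sigma_{j-1}\rangle$ as a subgroup of $P_n$, and let $T_j\trianglelefteq P_n$ be the base group of the wreath product $P_n=P_{n-j}\wr P_j=T_j\rtimes P_j$, i.e. the subgroup of those elements of $P_n$ that leave the first $j$ coordinates of every point unchanged; so $P_n=T_0\ge T_1\ge\cdots\ge T_n=1$, and we put $T_{n+1}=1$. The depth of a subgroup $S\le P_n$ is the largest $j\in\{0,\dots,n\}$ with $S\le T_j$. The quotient $T_j/T_j'$ is an elementary abelian $p$-group,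 and conjugation makes it an $\mathbb F_pP_j$-module. Let $r$ be a generator of $\mathbb F_p^\times$, let $\eta_i\in\operatorname{Sym}(\mathbb F_p^n)$ multiply the $i$-th coordinate by $r$, and let $H=\langle\eta_0,\dots,\eta_{n-1}\rangle$, which normalizes $P_n$ and acts on it by conjugation. **Proposition.** Let $N\trianglelefteq P_n$ be a normal subgroup of depth $j$, and let $K=T_j'=[T_j,T_j]$. Then $K\le N$, and the following statements are equivalent: 1. $N$ has a complement in $P_n$, i.e. there is a subgroup $C\le P_n$ with $N\cap C=1$ and $NC=P_n$. 2. $N$ has an $H$-invariant complement in $P_n$. 3. $N/K$ is a direct summand of the $\mathbb F_pP_j$-module $T_j/K$, and $NP_n'/P_n'$ is not a proper subgroup of $T_{j+1}P_n'/P_n'$. -/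

import Mathlib

open scoped MonoidAlgebra

namespace SylowMaschke

/-- The self-map of `𝔽_p^n` that adds `c` to the coordinate `i` of `x` if all coordinates of `x`
before the `i`-th one vanish, and fixes `x` otherwise. -/
def addAt {p n : ℕ} (i : Fin n) (c : ZMod p) (x : Fin n → ZMod p) : Fin n → ZMod p :=
  if ∀ k < i, x k = 0 then Function.update x i (x i + c) else x

theorem addAt_apply {p n : ℕ} (i : Fin n) (c : ZMod p) (x : Fin n → ZMod p) (k : Fin n) :
    addAt i c x k = if (∀ l < i, x l = 0) ∧ k = i then x k + c else x k := by
  unfold addAt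
  by_cases h : ∀ l < i, x l = 0
  · by_cases hk : k = i
    · rw [if_pos h, if_pos ⟨h, hk⟩, hk, Function.update_self]
    · rw [if_pos h, if_neg (fun h' => hk h'.2), Function.update_of_ne hk]
  · rw [if_neg h, if_neg (fun h' => h h'.1)]

theorem addAt_addAt {p n : ℕ} (i : Fin n) (c d : ZMod p) (x : Fin n → ZMod p) :
    addAt i c (addAt i d x) = addAt i (d + c) x := by
  have h : (∀ l < i, addAt i d x l = 0) ↔ ∀ l < i, x l = 0 := by
    refine forall₂_congr fun l hl => ?_
    rw [addAt_apply, if_neg (fun h => hl.ne h.2)]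
  funext k
  by_cases h' : (∀ l < i, x l = 0) ∧ k = i
  · rw [addAt_apply, if_pos ⟨h.2 h'.1, h'.2⟩, addAt_apply, if_pos h', addAt_apply, if_pos h']
    ring
  · rw [addAt_apply, if_neg (fun h2 => h' ⟨h.1 h2.1, h2.2⟩), addAt_apply, if_neg h', addAt_apply,
      if_neg h']

theorem addAt_zero {p n : ℕ} (i : Fin n) (x : Fin n → ZMod p) : addAt i 0 x = x := by
  funext k
  rw [addAt_apply]
  simp

/-- The permutation `σ_i` of `𝔽_p^n`: it applies the `p`-cycle `c ↦ c + 1` to the coordinate `i` of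
those points whose coordinates before the `i`-th one are all zero. -/
def sigma (p n : ℕ) (i : Fin n) : Equiv.Perm (Fin n → ZMod p) where
  toFun := addAt i 1
  invFun := addAt i (-1)
  left_inv x := by rw [addAt_addAt, add_neg_cancel, addAt_zero]
  right_inv x := by rw [addAt_addAt, neg_add_cancel, addAt_zero]

/-- The iterated wreath product `P_n = C_p ≀ ⋯ ≀ C_p` (`n` copies), realized as the Sylow
`p`-subgroup `⟨σ_0, …, σ_{n-1}⟩` of `Sym(𝔽_p^n)`. -/
def P (p n : ℕ) : Subgroup (Equiv.Perm (Fin n → ZMod p)) :=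
  Subgroup.closure (Set.range (sigma p n))

/-- The generator `σ_i` as an element of the group `P_n`. -/
def sigmaP (p n : ℕ) (i : Fin n) : P p n :=
  ⟨sigma p n i, Subgroup.subset_closure ⟨i, rfl⟩⟩

/-- `P_j`, viewed as the subgroup `⟨σ_0, …, σ_{j-1}⟩` of `P_n`. -/
def PSub (p n j : ℕ) : Subgroup (P p n) :=
  Subgroup.closure {g | ∃ i : Fin n, (i : ℕ) < j ∧ g = sigmaP p n i}

/-- The base group `T_j` of the wreath product `P_n = P_{n-j} ≀ P_j = (P_{n-j})^{p^j} ⋊ P_j`.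
As `P_n` acts on `𝔽_p^n = 𝔽_p^j × 𝔽_p^{n-j}` through `(g, s) (x, y) = (s x, g_{s x} y)`, it consists
of the elements of `P_n` that leave the first `j` coordinates of every point unchanged.
In particular it is trivial for `j ≥ n`. -/
def T (p n j : ℕ) : Subgroup (P p n) where
  carrier := {g | ∀ (x : Fin n → ZMod p) (k : Fin n), (k : ℕ) < j → g.1 x k = x k}
  one_mem' _ _ _ := rfl
  mul_mem' {a b} ha hb x k hk := (ha (b.1 x) k hk).trans (hb x k hk)
  inv_mem' {a} ha x k hk := by
    have h := ha ((a⁻¹ : P p n).1 x) k hk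
    simpa using h.symm

theorem mem_T {p n j : ℕ} {g : P p n} :
    g ∈ T p n j ↔ ∀ (x : Fin n → ZMod p) (k : Fin n), (k : ℕ) < j → g.1 x k = x k := Iff.rfl

theorem addAt_agree {p n : ℕ} (j : ℕ) (i : Fin n) (c : ZMod p) (x y : Fin n → ZMod p)
    (h : ∀ k : Fin n, (k : ℕ) < j → x k = y k) :
    ∀ k : Fin n, (k : ℕ) < j → addAt i c x k = addAt i c y k := by
  intro k hk
  rw [addAt_apply, addAt_apply, h k hk]
  by_cases hki : k = i
  · subst hki
    have : (∀ l < k, x l = 0) ↔ ∀ l < k, y l = 0 :=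
      forall₂_congr fun l hl => by rw [h l (lt_trans (Fin.lt_def.1 hl) hk)]
    simp only [this]
  · simp [hki]

theorem P_agree {p n : ℕ} (j : ℕ) (g : Equiv.Perm (Fin n → ZMod p)) (hg : g ∈ P p n) :
    ∀ x y : Fin n → ZMod p, (∀ k : Fin n, (k : ℕ) < j → x k = y k) ↔
      (∀ k : Fin n, (k : ℕ) < j → g x k = g y k) := by
  induction hg using Subgroup.closure_induction with
  | mem g hg =>
    obtain ⟨i, rfl⟩ := hg
    intro x y
    refine ⟨addAt_agree j i 1 x y, fun h => ?_⟩
    have h2 := addAt_agree j i (-1) _ _ h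
    have hx : ∀ z, addAt i (-1) (sigma p n i z) = z := (sigma p n i).left_inv
    rwa [hx, hx] at h2
  | one => intro x y; rfl
  | mul a b _ _ ha hb => intro x y; exact (hb x y).trans (ha (b x) (b y))
  | inv a _ ha =>
    intro x y
    have h := ha (a⁻¹ x) (a⁻¹ y)
    have e : ∀ z, a (a⁻¹ z) = z := a.apply_symm_apply
    rw [e, e] at h
    exact h.symm

instance T_normal (p n j : ℕ) : (T p n j).Normal where
  conj_mem t ht g := by
    intro x k hk
    have h1 := (P_agree j g.1 g.2 (t.1 ((g⁻¹ : P p n).1 x)) ((g⁻¹ : P p n).1 x)).1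
      (fun k hk => ht _ k hk) k hk
    simpa using h1

theorem sigmaP_mem_T {p n j : ℕ} (i : Fin n) (hi : j ≤ i) : sigmaP p n i ∈ T p n j := by
  intro x k hk
  change addAt i 1 x k = x k
  rw [addAt_apply, if_neg]
  rintro ⟨-, rfl⟩
  omega

theorem PSub_apply {p n j : ℕ} (g : P p n) (hg : g ∈ PSub p n j) :
    ∀ (x : Fin n → ZMod p) (k : Fin n), j ≤ (k : ℕ) → g.1 x k = x k := by
  induction hg using Subgroup.closure_induction with
  | mem g hg =>
    obtain ⟨i, hi, rfl⟩ := hg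
    intro x k hk
    change addAt i 1 x k = x k
    rw [addAt_apply, if_neg]
    rintro ⟨-, rfl⟩
    omega
  | one => intro x k _; rfl
  | mul a b _ _ ha hb => intro x k hk; exact (ha (b.1 x) k hk).trans (hb x k hk)
  | inv a _ ha =>
    intro x k hk
    have h := ha ((a⁻¹ : P p n).1 x) k hk
    simpa using h.symm

theorem P_eq_closure (p n : ℕ) : Subgroup.closure (Set.range (sigmaP p n)) = ⊤ := by
  have h : Subgroup.closure ((Subtype.val : P p n → _) ⁻¹' Set.range (sigma p n)) = ⊤ :=
    Subgroup.closure_closure_coe_preimage (k := Set.range (sigma p n))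
  refine Eq.trans ?_ h
  congr 1
  ext g
  constructor
  · rintro ⟨i, rfl⟩; exact ⟨i, rfl⟩
  · rintro ⟨i, hi⟩; exact ⟨i, Subtype.ext hi⟩

/-- `T_j` is generated by the `P_j`-conjugates of the `σ_i` with `i ≥ j`. -/
theorem T_eq_closure (p n j : ℕ) :
    T p n j = Subgroup.closure
      {t | ∃ g ∈ PSub p n j, ∃ i : Fin n, j ≤ (i : ℕ) ∧ t = g * sigmaP p n i * g⁻¹} := by
  set S : Set (P p n) :=
    {t | ∃ g ∈ PSub p n j, ∃ i : Fin n, j ≤ (i : ℕ) ∧ t = g * sigmaP p n i * g⁻¹} with hS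
  have hconj : ∀ g ∈ PSub p n j, ∀ t ∈ Subgroup.closure S, g * t * g⁻¹ ∈ Subgroup.closure S := by
    intro g hg t ht
    induction ht using Subgroup.closure_induction with
    | mem t ht =>
      obtain ⟨g', hg', i, hi, rfl⟩ := ht
      exact Subgroup.subset_closure ⟨g * g', mul_mem hg hg', i, hi, by group⟩
    | one => simp
    | mul a b _ _ ha hb =>
      have : g * (a * b) * g⁻¹ = (g * a * g⁻¹) * (g * b * g⁻¹) := by group
      rw [this]; exact mul_mem ha hb
    | inv a _ ha =>
      have : g * a⁻¹ * g⁻¹ = (g * a * g⁻¹)⁻¹ := by group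
      rw [this]; exact inv_mem ha
  have hsig : ∀ i : Fin n, j ≤ (i : ℕ) → sigmaP p n i ∈ Subgroup.closure S := fun i hi =>
    Subgroup.subset_closure ⟨1, one_mem _, i, hi, by simp⟩
  have hsub : Subgroup.closure S ≤ T p n j := by
    rw [Subgroup.closure_le]
    rintro _ ⟨g, -, i, hi, rfl⟩
    exact (T_normal p n j).conj_mem _ (sigmaP_mem_T i hi) g
  have hfac : ∀ g : P p n, ∃ t ∈ Subgroup.closure S, ∃ q ∈ PSub p n j, g = t * q := by
    intro g
    have hg : g ∈ Subgroup.closure (Set.range (sigmaP p n)) := by rw [P_eq_closure]; trivial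
    induction hg using Subgroup.closure_induction with
    | mem g hg =>
      obtain ⟨i, rfl⟩ := hg
      rcases lt_or_ge (i : ℕ) j with hi | hi
      · exact ⟨1, one_mem _, _, Subgroup.subset_closure ⟨i, hi, rfl⟩, by simp⟩
      · exact ⟨_, hsig i hi, 1, one_mem _, by simp⟩
    | one => exact ⟨1, one_mem _, 1, one_mem _, by simp⟩
    | mul a b _ _ ha hb =>
      obtain ⟨t, ht, q, hq, rfl⟩ := ha
      obtain ⟨t', ht', q', hq', rfl⟩ := hb
      exact ⟨t * (q * t' * q⁻¹), mul_mem ht (hconj q hq t' ht'), q * q', mul_mem hq hq', by group⟩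
    | inv a _ ha =>
      obtain ⟨t, ht, q, hq, rfl⟩ := ha
      refine ⟨q⁻¹ * t⁻¹ * q⁻¹⁻¹, hconj _ (inv_mem hq) _ (inv_mem ht), q⁻¹, inv_mem hq, by group⟩
  refine le_antisymm (fun g hg => ?_) hsub
  obtain ⟨t, ht, q, hq, rfl⟩ := hfac g
  have hqT : q ∈ T p n j := by
    have := mul_mem (inv_mem (hsub ht)) hg
    simpa using this
  have hq1 : q = 1 := by
    apply Subtype.ext
    refine Equiv.ext fun x => funext fun k => ?_
    rcases lt_or_ge (k : ℕ) j with hk | hk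
    · exact hqT x k hk
    · exact PSub_apply q hq x k hk
  rw [hq1, mul_one]
  exact ht

theorem sigmaP_pow (p n : ℕ) (i : Fin n) : sigmaP p n i ^ p = 1 := by
  have h : ∀ (m : ℕ) (x : Fin n → ZMod p), (sigma p n i ^ m) x = addAt i (m : ZMod p) x := by
    intro m
    induction m with
    | zero => intro x; simp [addAt_zero]
    | succ m ih =>
      intro x
      rw [pow_succ', Equiv.Perm.mul_apply, ih]
      change addAt i 1 (addAt i _ x) = _
      rw [addAt_addAt]; push_cast; rfl
  apply Subtype.ext
  ext1 x
  change (sigma p n i ^ p) x = x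
  rw [h, ZMod.natCast_self, addAt_zero]

/-- The quotient `T_j / K` with `K = T_j' = [T_j, T_j]`, written additively. -/
abbrev TBar (p n j : ℕ) : Type := Additive (Abelianization (T p n j))

theorem TBar_exists_rep {p n j : ℕ} (v : TBar p n j) :
    ∃ t : T p n j, Additive.ofMul (Abelianization.of t) = v :=
  QuotientGroup.mk_surjective (Additive.toMul v)

theorem TBar_nsmul (p n j : ℕ) (v : TBar p n j) : p • v = 0 := by
  obtain ⟨t, rfl⟩ := TBar_exists_rep v
  have key : ∀ (g : P p n) (hg : g ∈ T p n j),
      (Abelianization.of (⟨g, hg⟩ : T p n j)) ^ p = 1 := by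
    intro g hg
    have hg' := hg
    rw [T_eq_closure] at hg'
    induction hg' using Subgroup.closure_induction with
    | mem t ht =>
      obtain ⟨g', -, i, hi, rfl⟩ := ht
      rw [← map_pow]
      have : (⟨g' * sigmaP p n i * g'⁻¹, hg⟩ : T p n j) ^ p = 1 := by
        apply Subtype.ext
        change (g' * sigmaP p n i * g'⁻¹) ^ p = 1
        rw [conj_pow, sigmaP_pow]; simp
      rw [this, map_one]
    | one =>
      have : (⟨1, hg⟩ : T p n j) = 1 := rfl
      rw [this, map_one, one_pow]
    | mul a b ha hb iha ihb =>
      rw [← T_eq_closure] at ha hb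
      have : (⟨a * b, hg⟩ : T p n j) = ⟨a, ha⟩ * ⟨b, hb⟩ := rfl
      rw [this, map_mul, mul_pow, iha ha, ihb hb, one_mul]
    | inv a ha iha =>
      rw [← T_eq_closure] at ha
      have : (⟨a⁻¹, hg⟩ : T p n j) = ⟨a, ha⟩⁻¹ := rfl
      rw [this, map_inv, inv_pow, iha ha, inv_one]
  exact key t.1 t.2

/-- `T_j / K` is an elementary abelian `p`-group, hence a vector space over `𝔽_p`. -/
noncomputable instance TBar_module (p n j : ℕ) : Module (ZMod p) (TBar p n j) :=
  AddCommGroup.zmodModule (TBar_nsmul p n j)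

/-- The conjugation action `x • t K = x t x⁻¹ K` of `P_j` on `T_j / K`, as a representation
over `𝔽_p`. Its underlying `𝔽_p P_j`-module is `(rep p n j).asModule`. -/
noncomputable def rep (p n j : ℕ) : Representation (ZMod p) (PSub p n j) (TBar p n j) where
  toFun x := AddMonoidHom.toZModLinearMap p (MonoidHom.toAdditive
    (Abelianization.map (MulAut.conjNormal (H := T p n j) (x : P p n)).toMonoidHom))
  map_one' := by
    apply LinearMap.ext
    intro v
    obtain ⟨t, rfl⟩ := TBar_exists_rep v
    change Abelianization.map _ (Abelianization.of t) = Abelianization.of t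
    rw [Abelianization.map_of]
    rw [Subgroup.coe_one, map_one]
    rfl
  map_mul' x y := by
    apply LinearMap.ext
    intro v
    obtain ⟨t, rfl⟩ := TBar_exists_rep v
    change Abelianization.map _ (Abelianization.of t) =
      Abelianization.map _ (Abelianization.map _ (Abelianization.of t))
    rw [Abelianization.map_of, Abelianization.map_of, Abelianization.map_of]
    rw [Subgroup.coe_mul, map_mul]
    rfl

theorem rep_of {p n j : ℕ} (x : PSub p n j) (t : T p n j) :
    rep p n j x (Additive.ofMul (Abelianization.of t)) =
      Additive.ofMul (Abelianization.of (MulAut.conjNormal (x : P p n) t)) := rfl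

/-- The image of `N ∩ T_j` in `T_j / K`, for a normal subgroup `N` of `P_n`, as a subrepresentation.
If `K ≤ N ≤ T_j`, this is `N / K`. -/
noncomputable def NBar (p n j : ℕ) (N : Subgroup (P p n)) [hN : N.Normal] :
    Subrepresentation (rep p n j) where
  toSubmodule := AddSubgroup.toZModSubmodule p
    (Subgroup.toAddSubgroup ((N.subgroupOf (T p n j)).map Abelianization.of))
  apply_mem_toSubmodule x v hv := by
    obtain ⟨t, ht, rfl⟩ := (hv : ∃ t ∈ N.subgroupOf (T p n j), Abelianization.of t = v)
    change ∃ s ∈ N.subgroupOf (T p n j),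
      Abelianization.of s = Abelianization.of (MulAut.conjNormal (x : P p n) t)
    refine ⟨MulAut.conjNormal (x : P p n) t, ?_, rfl⟩
    replace ht : (t : P p n) ∈ N := ht
    rw [Subgroup.mem_subgroupOf, MulAut.conjNormal_apply]
    exact hN.conj_mem _ ht _

/-- `j` is the depth of `S ≤ P_n`: the largest `i ∈ {0, …, n}` with `S ≤ T_i`. -/
def HasDepth {p n : ℕ} (S : Subgroup (P p n)) (j : ℕ) : Prop :=
  IsGreatest {i : ℕ | i ≤ n ∧ S ≤ T p n i} j

/-- The permutation `η_i` of `𝔽_p^n`, which multiplies the coordinate `i` by the unit `r`. -/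
def eta {p n : ℕ} (r : (ZMod p)ˣ) (i : Fin n) : Equiv.Perm (Fin n → ZMod p) where
  toFun x := Function.update x i (r * x i)
  invFun x := Function.update x i ((r⁻¹ : (ZMod p)ˣ) * x i)
  left_inv x := by simp
  right_inv x := by simp

/-- The subgroup `H = ⟨η_0, …, η_{n-1}⟩` of `Sym(𝔽_p^n)`. -/
def H {p : ℕ} (n : ℕ) (r : (ZMod p)ˣ) : Subgroup (Equiv.Perm (Fin n → ZMod p)) :=
  Subgroup.closure (Set.range (eta r))

/-- `C ≤ P_n ≤ Sym(𝔽_p^n)` is invariant under conjugation by the elements of `H`. -/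
def IsHInvariant {p n : ℕ} (r : (ZMod p)ˣ) (C : Subgroup (P p n)) : Prop :=
  ∀ h ∈ H n r, ∀ c ∈ C.map (P p n).subtype, h * c * h⁻¹ ∈ C.map (P p n).subtype

end SylowMaschke

namespace SylowMaschke

variable {p n : ℕ}

/-- Two points agree in all coordinates before the `j`-th one. -/
def Agree (j : ℕ) (x y : Fin n → ZMod p) : Prop := ∀ k : Fin n, (k : ℕ) < j → x k = y k

instance (j : ℕ) (x y : Fin n → ZMod p) : Decidable (Agree j x y) := by
  unfold Agree
  infer_instance

theorem Agree.refl (j : ℕ) (x : Fin n → ZMod p) : Agree j x x := fun _ _ => rfl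

theorem Agree.symm {j : ℕ} {x y : Fin n → ZMod p} (h : Agree j x y) : Agree j y x :=
  fun k hk => (h k hk).symm

theorem Agree.trans {j : ℕ} {x y z : Fin n → ZMod p} (h : Agree j x y) (h' : Agree j y z) :
    Agree j x z :=
  fun k hk => (h k hk).trans (h' k hk)

theorem Agree.mono {i j : ℕ} (hij : i ≤ j) {x y : Fin n → ZMod p} (h : Agree j x y) :
    Agree i x y :=
  fun k hk => h k (hk.trans_le hij)

theorem agree_apply_iff (g : P p n) {j : ℕ} {x y : Fin n → ZMod p} :
    Agree j (g.1 x) (g.1 y) ↔ Agree j x y :=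
  (P_agree j g.1 g.2 x y).symm

theorem agree_inv_apply_iff (g : P p n) {j : ℕ} {x y : Fin n → ZMod p} :
    Agree j (g⁻¹.1 x) y ↔ Agree j x (g.1 y) := by
  rw [← agree_apply_iff g]
  simp

theorem agree_of_mem_T {j : ℕ} {t : P p n} (ht : t ∈ T p n j) (x : Fin n → ZMod p) :
    Agree j (t.1 x) x :=
  fun k hk => ht x k hk

theorem mul_apply (g h : P p n) (x : Fin n → ZMod p) : (g * h).1 x = g.1 (h.1 x) := rfl

theorem apply_inv_apply (g : P p n) (x : Fin n → ZMod p) : g.1 (g⁻¹.1 x) = x :=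
  g.1.apply_symm_apply x

theorem inv_apply_apply (g : P p n) (x : Fin n → ZMod p) : g⁻¹.1 (g.1 x) = x :=
  g.1.symm_apply_apply x

theorem sigma_apply (i : Fin n) (x : Fin n → ZMod p) (k : Fin n) :
    (sigmaP p n i).1 x k = if Agree i x 0 ∧ k = i then x k + 1 else x k := by
  refine (addAt_apply i 1 x k).trans ?_
  congr 1

theorem sigma_pow_apply (i : Fin n) (m : ℕ) (x : Fin n → ZMod p) :
    (sigmaP p n i ^ m).1 x = addAt i (m : ZMod p) x := by
  induction m with
  | zero => simp [addAt_zero]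
  | succ m ih =>
    rw [pow_succ', mul_apply, ih]
    change addAt i 1 (addAt i _ x) = _
    rw [addAt_addAt]; push_cast; rfl

/-- A permutation is triangular if it changes each coordinate by an amount that only depends on the
previous coordinates. -/
def Triangular (g : Equiv.Perm (Fin n → ZMod p)) : Prop :=
  ∀ (i : Fin n) (x y : Fin n → ZMod p), Agree i x y → g x i - x i = g y i - y i

theorem Triangular.agree {g : Equiv.Perm (Fin n → ZMod p)} (hg : Triangular g) {j : ℕ}
    {x y : Fin n → ZMod p} (h : Agree j x y) : Agree j (g x) (g y) := by
  intro k hk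
  have := hg k x y (h.mono hk.le)
  rw [h k hk] at this
  exact sub_left_injective this

theorem Triangular.mul {g h : Equiv.Perm (Fin n → ZMod p)} (hg : Triangular g)
    (hh : Triangular h) : Triangular (g * h) := by
  intro i x y hxy
  have h1 := hg i _ _ (hh.agree hxy)
  have h2 := hh i _ _ hxy
  simp only [Equiv.Perm.mul_apply]
  linear_combination h1 + h2

theorem triangular_of_mem (g : P p n) : Triangular g.1 := by
  intro i x y hxy
  have key : ∀ g ∈ P p n, ∀ x y : Fin n → ZMod p, Agree i x y → g x i - x i = g y i - y i := by
    intro g hg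
    induction hg using Subgroup.closure_induction with
    | mem g hg =>
      obtain ⟨k, rfl⟩ := hg
      intro x y hxy
      have e : ∀ z, sigma p n k z i = if Agree k z 0 ∧ i = k then z i + 1 else z i :=
        fun z => sigma_apply k z i
      rw [e, e]
      by_cases hik : i = k
      · subst hik
        have : Agree i x 0 ↔ Agree i y 0 :=
          ⟨fun h => hxy.symm.trans h, fun h => hxy.trans h⟩
        by_cases h : Agree i y 0 <;> simp [this, h]
      · simp [hik]
    | one => intro x y _; simp
    | mul a b ha hb iha ihb =>
      intro x y hxy
      have h1 := iha _ _ ((agree_apply_iff ⟨b, hb⟩).2 hxy)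
      have h2 := ihb _ _ hxy
      simp only [Equiv.Perm.mul_apply]
      simp only at h1
      linear_combination h1 + h2
    | inv a ha iha =>
      intro x y hxy
      have h1 := iha _ _ ((agree_apply_iff (⟨a, ha⟩ : P p n)⁻¹).2 hxy)
      have e : ∀ z, a (a⁻¹ z) = z := a.apply_symm_apply
      change a (a⁻¹ x) i - a⁻¹ x i = a (a⁻¹ y) i - a⁻¹ y i at h1
      rw [e, e] at h1
      linear_combination -h1
  exact key g.1 g.2 x y hxy

/-- Two elements of `P_n` that agree as functions are equal. -/
theorem P_ext {g h : P p n} (H : ∀ x k, g.1 x k = h.1 x k) : g = h :=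
  Subtype.ext (Equiv.ext fun x => funext fun k => H x k)

theorem conj_sigma_apply {j : ℕ} {i : Fin n} (hji : j ≤ i) {h : P p n} (hh : h ∈ PSub p n j)
    (x : Fin n → ZMod p) (k : Fin n) :
    (h * sigmaP p n i * h⁻¹).1 x k = if Agree i x (h.1 0) ∧ k = i then x k + 1 else x k := by
  have hz : Agree i (h⁻¹.1 x) 0 ↔ Agree i x (h.1 0) := agree_inv_apply_iff h
  rw [mul_apply, mul_apply]
  rcases lt_or_ge (k : ℕ) j with hk | hk
  · rw [if_neg (by rintro ⟨-, rfl⟩; omega)]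
    have h1 : Agree j ((sigmaP p n i).1 (h⁻¹.1 x)) (h⁻¹.1 x) :=
      agree_of_mem_T (sigmaP_mem_T i hji) _
    have h2 := (agree_apply_iff h).2 h1 k hk
    rwa [apply_inv_apply] at h2
  · have h3 : h⁻¹.1 x k = x k := PSub_apply h⁻¹ (inv_mem hh) x k hk
    rw [PSub_apply h hh _ k hk, sigma_apply, h3]
    simp only [hz]

theorem sigmaP_mem_PSub {j : ℕ} {i : Fin n} (hi : (i : ℕ) < j) : sigmaP p n i ∈ PSub p n j :=
  Subgroup.subset_closure ⟨i, hi, rfl⟩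

theorem exists_mem_PSub_agree [NeZero p] (j : ℕ) (y : Fin n → ZMod p) :
    ∃ g ∈ PSub p n j, Agree j (g.1 0) y := by
  have key : ∀ m ≤ j, ∃ g ∈ PSub p n j, ∀ k : Fin n,
      ((k : ℕ) < j - m → g.1 0 k = 0) ∧ (j - m ≤ (k : ℕ) → (k : ℕ) < j → g.1 0 k = y k) := by
    intro m
    induction m with
    | zero =>
      intro _
      refine ⟨1, one_mem (PSub p n j), fun k => ⟨fun _ => rfl, fun h h' => ?_⟩⟩
      omega
    | succ m ih =>
      intro hm
      obtain ⟨g, hg, hgk⟩ := ih (by omega)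
      by_cases hn : j - (m + 1) < n
      · let i : Fin n := ⟨j - (m + 1), hn⟩
        have hi : (i : ℕ) = j - (m + 1) := rfl
        refine ⟨sigmaP p n i ^ (y i).val * g, mul_mem (pow_mem (sigmaP_mem_PSub (by omega)) _) hg,
          fun k => ?_⟩
        have h0 : ∀ l < i, g.1 0 l = 0 := fun l hl => (hgk l).1 (by
          have := Fin.lt_def.1 hl; omega)
        rw [mul_apply, sigma_pow_apply, addAt_apply]
        refine ⟨fun hk => ?_, fun hk hk' => ?_⟩
        · rw [if_neg (by rintro ⟨-, rfl⟩; omega)]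
          exact (hgk k).1 (by omega)
        · by_cases hki : k = i
          · subst hki
            rw [if_pos ⟨h0, rfl⟩, (hgk i).1 (by omega)]
            simp
          · rw [if_neg (fun h => hki h.2)]
            refine (hgk k).2 ?_ hk'
            have : (k : ℕ) ≠ i := fun h => hki (Fin.ext h)
            omega
      · refine ⟨g, hg, fun k => ⟨fun hk => (hgk k).1 (by omega), fun hk hk' => ?_⟩⟩
        have := k.2
        omega
  obtain ⟨g, hg, h⟩ := key j le_rfl
  exact ⟨g, hg, fun k hk => (h k).2 (by omega) hk⟩

/-- The permutation that adds `φ x` to the coordinate `i` of `x`, where `φ` only depends on the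
coordinates before the `i`-th one. -/
def shear (i : Fin n) (φ : (Fin n → ZMod p) → ZMod p) (hφ : ∀ x y, Agree i x y → φ x = φ y) :
    Equiv.Perm (Fin n → ZMod p) where
  toFun x := Function.update x i (x i + φ x)
  invFun x := Function.update x i (x i - φ x)
  left_inv x := by
    have : φ (Function.update x i (x i + φ x)) = φ x := hφ _ _ fun k hk =>
      Function.update_of_ne (by rintro rfl; omega) _ _
    simp [this]
  right_inv x := by
    have : φ (Function.update x i (x i - φ x)) = φ x := hφ _ _ fun k hk =>
      Function.update_of_ne (by rintro rfl; omega) _ _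
    simp [this]

theorem shear_apply (i : Fin n) (φ : (Fin n → ZMod p) → ZMod p)
    (hφ : ∀ x y, Agree i x y → φ x = φ y) (x : Fin n → ZMod p) (k : Fin n) :
    shear i φ hφ x k = if k = i then x k + φ x else x k := by
  change Function.update x i (x i + φ x) k = _
  by_cases h : k = i
  · subst h; simp
  · simp [h]

theorem triangular_shear (i : Fin n) (φ : (Fin n → ZMod p) → ZMod p)
    (hφ : ∀ x y, Agree i x y → φ x = φ y) : Triangular (shear i φ hφ) := by
  intro k x y hxy
  rw [shear_apply, shear_apply]
  by_cases h : k = i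
  · subst h; simp [hφ x y hxy]
  · simp [h]

theorem shear_add (i : Fin n) (φ ψ : (Fin n → ZMod p) → ZMod p)
    (hφ : ∀ x y, Agree i x y → φ x = φ y) (hψ : ∀ x y, Agree i x y → ψ x = ψ y) :
    shear i φ hφ * shear i ψ hψ =
      shear i (fun x => φ x + ψ x) (fun x y h => by rw [hφ x y h, hψ x y h]) := by
  refine Equiv.ext fun x => funext fun k => ?_
  have : φ (shear i ψ hψ x) = φ x := hφ _ _ fun l hl => by
    rw [shear_apply, if_neg (by rintro rfl; omega)]
  rw [Equiv.Perm.mul_apply, shear_apply, shear_apply, shear_apply, this]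
  by_cases h : k = i
  · simp [h]; ring
  · simp [h]

theorem shear_indicator_mem [NeZero p] (i : Fin n) (y : Fin n → ZMod p) (c : ZMod p) :
    shear i (fun x => if Agree i x y then c else 0) (fun x x' h => by
      have : Agree i x y ↔ Agree i x' y := ⟨h.symm.trans, h.trans⟩
      simp only [this]) ∈ P p n := by
  have key : ∀ m : ℕ, shear i (fun x => if Agree i x y then (m : ZMod p) else 0) (fun x x' h => by
      have : Agree i x y ↔ Agree i x' y := ⟨h.symm.trans, h.trans⟩
      simp only [this]) ∈ P p n := by
    intro m
    induction m with
    | zero =>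
      convert one_mem (P p n)
      refine Equiv.ext fun x => funext fun k => ?_
      rw [shear_apply]; simp
    | succ m ih =>
      obtain ⟨g, hg, hgy⟩ := exists_mem_PSub_agree (p := p) (i : ℕ) y
      convert mul_mem ih (g * sigmaP p n i * g⁻¹).2 using 1
      have e : (g * sigmaP p n i * g⁻¹).1 =
          shear i (fun x => if Agree i x y then 1 else 0) (fun x x' h => by
            have : Agree i x y ↔ Agree i x' y := ⟨h.symm.trans, h.trans⟩
            simp only [this]) := by
        refine Equiv.ext fun x => funext fun k => ?_
        have : Agree i x (g.1 0) ↔ Agree i x y :=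
          ⟨fun h => h.trans hgy, fun h => h.trans hgy.symm⟩
        rw [conj_sigma_apply le_rfl hg, shear_apply]
        simp only [this]
        by_cases h1 : Agree i x y <;> by_cases h2 : k = i <;> simp [h1, h2]
      rw [e, shear_add]
      congr 1
      funext x
      by_cases h1 : Agree i x y <;> simp [h1]
  have := key c.val
  simpa using this

/-- The point with the same coordinates as `x` before the `j`-th one, and zeros afterwards. -/
def trunc (j : ℕ) (x : Fin n → ZMod p) : Fin n → ZMod p := fun k => if (k : ℕ) < j then x k else 0

theorem trunc_agree (j : ℕ) (x : Fin n → ZMod p) : Agree j (trunc j x) x := fun k hk => by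
  simp [trunc, hk]

theorem trunc_of_le {j : ℕ} (x : Fin n → ZMod p) {k : Fin n} (hk : j ≤ k) : trunc j x k = 0 := by
  simp [trunc, hk]

theorem eq_trunc {j : ℕ} {x y : Fin n → ZMod p} (h : Agree j x y)
    (hx : ∀ k : Fin n, j ≤ k → x k = 0) : x = trunc j y := by
  funext k
  rcases lt_or_ge (k : ℕ) j with hk | hk
  · simp [trunc, hk, h k hk]
  · rw [trunc_of_le _ hk, hx k hk]

theorem shear_mem [NeZero p] (i : Fin n) (φ : (Fin n → ZMod p) → ZMod p)
    (hφ : ∀ x y, Agree i x y → φ x = φ y) : shear i φ hφ ∈ P p n := by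
  have key : ∀ s : Finset (Fin n → ZMod p),
      shear i (fun x => ∑ y ∈ s, if Agree i x y then φ y else 0) (fun x x' h => by
        have : ∀ y, Agree i x y ↔ Agree i x' y := fun y => ⟨h.symm.trans, h.trans⟩
        simp only [this]) ∈ P p n := by
    intro s
    induction s using Finset.induction_on with
    | empty =>
      convert one_mem (P p n)
      refine Equiv.ext fun x => funext fun k => ?_
      rw [shear_apply]; simp
    | insert a s ha ih =>
      have := mul_mem (shear_indicator_mem i a (φ a)) ih
      rw [shear_add] at this
      simpa only [Finset.sum_insert ha] using this
  convert key (Finset.univ.filter fun y => ∀ k : Fin n, (i : ℕ) ≤ k → y k = 0) using 2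
  funext x
  rw [Finset.sum_eq_single (trunc i x)]
  · rw [if_pos (trunc_agree _ x).symm]
    exact hφ _ _ (trunc_agree _ x).symm
  · intro y hy hne
    rw [if_neg]
    intro h
    exact hne (eq_trunc h.symm (Finset.mem_filter.1 hy).2)
  · intro h
    exact absurd (Finset.mem_filter.2 ⟨Finset.mem_univ _, fun k hk => trunc_of_le x hk⟩) h

/-- `P_n` is the group of all triangular permutations. -/
theorem mem_P_iff [NeZero p] {g : Equiv.Perm (Fin n → ZMod p)} : g ∈ P p n ↔ Triangular g := by
  refine ⟨fun hg => triangular_of_mem ⟨g, hg⟩, fun hg => ?_⟩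
  have key : ∀ m : ℕ, ∀ g : Equiv.Perm (Fin n → ZMod p), Triangular g →
      (∀ x, Agree (n - m) (g x) x) → g ∈ P p n := by
    intro m
    induction m with
    | zero =>
      intro g _ h
      have : g = 1 := Equiv.ext fun x => funext fun k => h x k (by simp)
      rw [this]; exact one_mem _
    | succ m ih =>
      intro g hg h
      by_cases hm : m < n
      · let i : Fin n := ⟨n - (m + 1), by omega⟩
        have hi : (i : ℕ) = n - (m + 1) := rfl
        have h1 : ∀ x y : Fin n → ZMod p, Agree i x y → x i - g x i = y i - g y i :=
          fun x y hxy => by linear_combination -hg i x y hxy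
        have h2 : g * shear i (fun x => x i - g x i) h1 ∈ P p n := by
          refine ih _ (hg.mul (triangular_shear _ _ _)) fun x k hk => ?_
          have h3 : Agree i (shear i (fun x => x i - g x i) h1 x) x := fun l hl => by
            rw [shear_apply, if_neg (by rintro rfl; omega)]
          rw [Equiv.Perm.mul_apply]
          by_cases hki : k = i
          · subst hki
            have h4 := hg i _ _ h3
            rw [shear_apply, if_pos rfl] at h4
            linear_combination h4
          · have h5 : (k : ℕ) < i := by
              have : (k : ℕ) ≠ i := fun h => hki (Fin.ext h)
              omega
            rw [h _ k (by omega), h3 k h5]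
        have h3 := mul_mem h2 (inv_mem (shear_mem i (fun x => x i - g x i) h1))
        rwa [mul_inv_cancel_right] at h3
      · refine ih g hg ?_
        have e : n - m = n - (m + 1) := by omega
        rwa [e]
  refine key n g hg fun x k hk => ?_
  omega

theorem exists_T_mul_PSub (j : ℕ) (g : P p n) :
    ∃ t ∈ T p n j, ∃ q ∈ PSub p n j, g = t * q := by
  have h : T p n j ⊔ PSub p n j = ⊤ := by
    rw [← top_le_iff, ← P_eq_closure, Subgroup.closure_le]
    rintro _ ⟨i, rfl⟩
    rcases lt_or_ge (i : ℕ) j with hi | hi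
    · exact Subgroup.mem_sup_right (sigmaP_mem_PSub hi)
    · exact Subgroup.mem_sup_left (sigmaP_mem_T i hi)
  have hg : g ∈ T p n j ⊔ PSub p n j := h ▸ Subgroup.mem_top g
  obtain ⟨t, ht, q, hq, e⟩ := Subgroup.mem_sup_of_normal_left.1 hg
  exact ⟨t, ht, q, hq, e.symm⟩

theorem eq_one_of_mem_T_of_fix {j : ℕ} {g : P p n} (hg : g ∈ T p n j)
    (h : ∀ x (k : Fin n), j ≤ (k : ℕ) → g.1 x k = x k) : g = 1 :=
  P_ext fun x k => (lt_or_ge (k : ℕ) j).elim (hg x k) (h x k)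

theorem mem_PSub_iff {j : ℕ} {g : P p n} :
    g ∈ PSub p n j ↔ ∀ x (k : Fin n), j ≤ (k : ℕ) → g.1 x k = x k := by
  refine ⟨PSub_apply g, fun h => ?_⟩
  obtain ⟨t, ht, q, hq, rfl⟩ := exists_T_mul_PSub j g
  have : t = 1 := eq_one_of_mem_T_of_fix ht fun x k hk => by
    have h1 := h (q⁻¹.1 x) k hk
    rw [mul_apply, apply_inv_apply] at h1
    rw [h1]
    exact PSub_apply _ (inv_mem hq) x k hk
  rwa [this, one_mul]

theorem conj_sigma_eq {j : ℕ} {i : Fin n} (hji : j ≤ i) {h h' : P p n} (hh : h ∈ PSub p n j)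
    (hh' : h' ∈ PSub p n j) (he : Agree j (h.1 0) (h'.1 0)) :
    h * sigmaP p n i * h⁻¹ = h' * sigmaP p n i * h'⁻¹ := by
  refine P_ext fun x k => ?_
  have h1 : h.1 0 = h'.1 0 := by
    funext l
    rcases lt_or_ge (l : ℕ) j with hl | hl
    · exact he l hl
    · rw [PSub_apply h hh _ l hl, PSub_apply h' hh' _ l hl]
  rw [conj_sigma_apply hji hh, conj_sigma_apply hji hh', h1]

/-- The class of an element of `T_j` in `T_j / T_j'`. -/
def cls {j : ℕ} (t : P p n) (ht : t ∈ T p n j) : TBar p n j :=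
  Additive.ofMul (Abelianization.of ⟨t, ht⟩)

theorem cls_mul {j : ℕ} {s t : P p n} (hs : s ∈ T p n j) (ht : t ∈ T p n j) :
    cls (s * t) (mul_mem hs ht) = cls s hs + cls t ht := rfl

theorem exists_cls {j : ℕ} (v : TBar p n j) : ∃ (t : P p n) (ht : t ∈ T p n j), cls t ht = v := by
  obtain ⟨t, rfl⟩ := TBar_exists_rep v
  exact ⟨t.1, t.2, rfl⟩

theorem cls_eq_zero_iff {j : ℕ} {t : P p n} (ht : t ∈ T p n j) :
    cls t ht = 0 ↔ t ∈ ⁅T p n j, T p n j⁆ := by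
  rw [← Subgroup.map_subtype_commutator]
  change Abelianization.of (⟨t, ht⟩ : T p n j) = 1 ↔ _
  rw [← MonoidHom.mem_ker, Abelianization.ker_of]
  constructor
  · intro h
    exact ⟨_, h, rfl⟩
  · rintro ⟨s, hs, rfl⟩
    exact hs

theorem rep_cls {j : ℕ} (x : PSub p n j) {t : P p n} (ht : t ∈ T p n j) :
    rep p n j x (cls t ht) =
      cls ((x : P p n) * t * (x : P p n)⁻¹) ((T_normal p n j).conj_mem t ht x) := rfl

theorem conj_sigma_mem_T {j : ℕ} {i : Fin n} (hi : j ≤ i) (g : P p n) :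
    g * sigmaP p n i * g⁻¹ ∈ T p n j :=
  (T_normal p n j).conj_mem _ (sigmaP_mem_T i hi) g

/-- `T_j / T_j'` is spanned by the classes of the `P_j`-conjugates of the `σ_i` with `i ≥ j`. -/
theorem span_cls_conj_sigma (j : ℕ) :
    Submodule.span (ZMod p) {v : TBar p n j | ∃ g ∈ PSub p n j, ∃ (i : Fin n) (hi : j ≤ i),
      v = cls _ (conj_sigma_mem_T hi g)} = ⊤ := by
  rw [eq_top_iff]
  rintro v -
  obtain ⟨t, ht, rfl⟩ := exists_cls v
  have ht' := ht
  rw [T_eq_closure] at ht'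
  induction ht' using Subgroup.closure_induction with
  | mem t h =>
    obtain ⟨g, hg, i, hi, rfl⟩ := h
    exact Submodule.subset_span ⟨g, hg, i, hi, rfl⟩
  | one => exact zero_mem _
  | mul a b ha hb iha ihb =>
    rw [← T_eq_closure] at ha hb
    exact add_mem (iha ha) (ihb hb)
  | inv a ha iha =>
    rw [← T_eq_closure] at ha
    exact neg_mem (iha ha)

theorem T_zero : T p n 0 = ⊤ := eq_top_iff.2 fun _ _ _ _ hk => absurd hk (Nat.not_lt_zero _)

theorem T_self : T p n n = ⊥ := by
  rw [eq_bot_iff]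
  intro g hg
  exact P_ext fun x k => hg x k k.2

end SylowMaschke

namespace SylowMaschke

variable {p n : ℕ} [NeZero p]

/-- The points that agree with `y` before the `j`-th coordinate and vanish from the `i`-th one on.
They represent the vertices of level `i` below the vertex `y` of level `j`. -/
def fiber (j i : ℕ) (y : Fin n → ZMod p) : Finset (Fin n → ZMod p) :=
  Finset.univ.filter fun x => Agree j x y ∧ ∀ k : Fin n, i ≤ k → x k = 0

theorem mem_fiber {j i : ℕ} {x y : Fin n → ZMod p} :
    x ∈ fiber j i y ↔ Agree j x y ∧ ∀ k : Fin n, i ≤ k → x k = 0 := by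
  simp [fiber]

/-- The sum over all vertices of level `i` below the vertex `y` of level `j` of the amounts that
`g` adds to the coordinate `i`. -/
def fiberSum (j : ℕ) (i : Fin n) (g : P p n) (y : Fin n → ZMod p) : ZMod p :=
  ∑ x ∈ fiber j i y, (g.1 x i - x i)

theorem fiberSum_congr {j : ℕ} {i : Fin n} (g : P p n) {y y' : Fin n → ZMod p} (h : Agree j y y') :
    fiberSum j i g y = fiberSum j i g y' := by
  unfold fiberSum
  congr 1
  ext x
  rw [mem_fiber, mem_fiber]
  exact and_congr_left fun _ => ⟨fun h' => h'.trans h, fun h' => h'.trans h.symm⟩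

theorem fiberSum_mul {j : ℕ} {i : Fin n} (hji : j ≤ i) (g h : P p n) (y : Fin n → ZMod p) :
    fiberSum j i (g * h) y = fiberSum j i g (h.1 y) + fiberSum j i h y := by
  have key : ∑ x ∈ fiber j i y, (g.1 (h.1 x) i - h.1 x i) = fiberSum j i g (h.1 y) := by
    refine Finset.sum_nbij' (fun x => trunc i (h.1 x)) (fun z => trunc i (h⁻¹.1 z)) ?_ ?_ ?_ ?_ ?_
    · intro x hx
      rw [mem_fiber] at hx ⊢
      exact ⟨((trunc_agree _ _).mono hji).trans ((agree_apply_iff h).2 hx.1),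
        fun k hk => trunc_of_le _ hk⟩
    · intro x hx
      rw [mem_fiber] at hx ⊢
      exact ⟨((trunc_agree _ _).mono hji).trans ((agree_inv_apply_iff h).2 hx.1),
        fun k hk => trunc_of_le _ hk⟩
    · intro x hx
      exact (eq_trunc ((agree_inv_apply_iff h).2 (trunc_agree _ _)).symm (mem_fiber.1 hx).2).symm
    · intro x hx
      refine (eq_trunc (Agree.symm ?_) (mem_fiber.1 hx).2).symm
      have := (agree_apply_iff h).2 (trunc_agree i (h⁻¹.1 x))
      rwa [apply_inv_apply] at this
    · intro x _
      exact triangular_of_mem g i _ _ (trunc_agree _ _).symm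
  rw [← key, fiberSum, fiberSum, ← Finset.sum_add_distrib]
  refine Finset.sum_congr rfl fun x _ => ?_
  rw [mul_apply]
  ring

theorem fiberSum_eq_zero {j : ℕ} {i : Fin n} (hij : (i : ℕ) < j) {t : P p n} (ht : t ∈ T p n j)
    (l : ℕ) (y : Fin n → ZMod p) : fiberSum l i t y = 0 :=
  Finset.sum_eq_zero fun x _ => by rw [ht x i hij, sub_self]

theorem fiberSum_mul_of_mem_T {j : ℕ} (i : Fin n) {s t : P p n} (hs : s ∈ T p n j)
    (ht : t ∈ T p n j) (y : Fin n → ZMod p) :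
    fiberSum j i (s * t) y = fiberSum j i s y + fiberSum j i t y := by
  rcases lt_or_ge (i : ℕ) j with h | h
  · rw [fiberSum_eq_zero h hs, fiberSum_eq_zero h ht, fiberSum_eq_zero h (mul_mem hs ht), add_zero]
  · rw [fiberSum_mul h, fiberSum_congr s (agree_of_mem_T ht y)]

theorem fiberSum_conj {j : ℕ} (i : Fin n) (g : P p n) {t : P p n} (ht : t ∈ T p n j)
    (y : Fin n → ZMod p) : fiberSum j i (g * t * g⁻¹) (g.1 y) = fiberSum j i t y := by
  rcases lt_or_ge (i : ℕ) j with h | h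
  · rw [fiberSum_eq_zero h ht, fiberSum_eq_zero h ((T_normal p n j).conj_mem t ht g)]
  · have h1 := fiberSum_mul h (g * t * g⁻¹) g y
    rw [inv_mul_cancel_right, fiberSum_mul h, fiberSum_congr g (agree_of_mem_T ht y)] at h1
    linear_combination -h1

theorem fiberSum_tower {j l : ℕ} {i : Fin n} (hjl : j ≤ l) (g : P p n)
    (y : Fin n → ZMod p) : fiberSum j i g y = ∑ z ∈ fiber j l y, fiberSum l i g z := by
  have hmaps : ∀ x ∈ fiber j i y, trunc l x ∈ fiber j l y := by
    intro x hx
    rw [mem_fiber] at hx ⊢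
    exact ⟨((trunc_agree _ _).mono hjl).trans hx.1, fun k hk => trunc_of_le _ hk⟩
  rw [fiberSum, ← Finset.sum_fiberwise_of_maps_to hmaps]
  refine Finset.sum_congr rfl fun z hz => ?_
  rw [mem_fiber] at hz
  rw [fiberSum]
  congr 1
  ext x
  rw [Finset.mem_filter, mem_fiber, mem_fiber]
  constructor
  · rintro ⟨⟨-, h2⟩, rfl⟩
    exact ⟨(trunc_agree _ _).symm, h2⟩
  · rintro ⟨h1, h2⟩
    exact ⟨⟨(h1.mono hjl).trans hz.1, h2⟩, (eq_trunc h1.symm hz.2).symm⟩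

theorem fiberSum_self (i : Fin n) (g : P p n) (y : Fin n → ZMod p) :
    fiberSum i i g y = g.1 y i - y i := by
  rw [fiberSum, Finset.sum_eq_single (trunc i y)]
  · exact triangular_of_mem g i _ _ (trunc_agree _ _)
  · intro x hx hne
    rw [mem_fiber] at hx
    exact absurd (eq_trunc hx.1 hx.2) hne
  · intro h
    exact absurd (mem_fiber.2 ⟨trunc_agree _ _, fun k hk => trunc_of_le _ hk⟩) h

theorem fiberSum_conj_sigma {j : ℕ} {k : Fin n} (hjk : j ≤ k) {h : P p n} (hh : h ∈ PSub p n j)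
    (i : Fin n) (y : Fin n → ZMod p) :
    fiberSum j i (h * sigmaP p n k * h⁻¹) y = if i = k ∧ Agree j y (h.1 0) then 1 else 0 := by
  have e : ∀ x, (h * sigmaP p n k * h⁻¹).1 x i - x i =
      if Agree k x (h.1 0) ∧ i = k then 1 else 0 := by
    intro x
    rw [conj_sigma_apply hjk hh]
    split_ifs <;> ring
  have h0 : ∀ l : Fin n, j ≤ l → h.1 0 l = 0 := fun l hl => PSub_apply h hh 0 l hl
  simp only [fiberSum, e]
  by_cases hik : i = k
  · subst hik
    by_cases hy : Agree j y (h.1 0)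
    · rw [if_pos ⟨rfl, hy⟩, Finset.sum_eq_single (h.1 0)]
      · rw [if_pos ⟨Agree.refl _ _, rfl⟩]
      · intro x hx hne
        rw [mem_fiber] at hx
        rw [if_neg]
        rintro ⟨h1, -⟩
        exact hne ((eq_trunc h1 hx.2).trans
          (eq_trunc (Agree.refl _ _) fun l hl => h0 l (hjk.trans hl)).symm)
      · intro h1
        exact absurd (mem_fiber.2 ⟨hy.symm, fun l hl => h0 l (hjk.trans hl)⟩) h1
    · rw [if_neg (fun h => hy h.2)]
      refine Finset.sum_eq_zero fun x hx => if_neg ?_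
      rintro ⟨h1, -⟩
      exact hy ((mem_fiber.1 hx).1.symm.trans (h1.mono hjk))
  · simp [hik]

/-- The homomorphism `T_j → 𝔽_p` given by `fiberSum`. -/
def fiberHom (j : ℕ) (i : Fin n) (y : Fin n → ZMod p) : T p n j →* Multiplicative (ZMod p) :=
  MonoidHom.mk' (fun t => Multiplicative.ofAdd (fiberSum j i t y)) fun s t =>
    congrArg Multiplicative.ofAdd (fiberSum_mul_of_mem_T i s.2 t.2 y)

theorem fiberSum_pow {j : ℕ} (i : Fin n) (y : Fin n → ZMod p) {g : P p n} (hg : g ∈ T p n j)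
    (m : ℕ) : fiberSum j i (g ^ m) y = m * fiberSum j i g y := by
  have h1 := congrArg Multiplicative.toAdd (map_pow (fiberHom j i y) ⟨g, hg⟩ m)
  rw [toAdd_pow, nsmul_eq_mul] at h1
  exact h1

/-- The linear functional on `T_j / T_j'` given by `fiberSum`. -/
noncomputable def coord (j : ℕ) (i : Fin n) (y : Fin n → ZMod p) :
    TBar p n j →ₗ[ZMod p] ZMod p :=
  AddMonoidHom.toZModLinearMap p (MonoidHom.toAdditiveLeft (Abelianization.lift (fiberHom j i y)))

theorem coord_cls {j : ℕ} (i : Fin n) (y : Fin n → ZMod p) {t : P p n} (ht : t ∈ T p n j) :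
    coord j i y (cls t ht) = fiberSum j i t y := rfl

theorem coord_congr {j : ℕ} (i : Fin n) {y y' : Fin n → ZMod p} (h : Agree j y y')
    (v : TBar p n j) : coord j i y v = coord j i y' v := by
  obtain ⟨t, ht, rfl⟩ := exists_cls v
  exact fiberSum_congr t h

theorem coord_rep {j : ℕ} (i : Fin n) (x : PSub p n j) (y : Fin n → ZMod p) (v : TBar p n j) :
    coord j i (x.1.1 y) (rep p n j x v) = coord j i y v := by
  obtain ⟨t, ht, rfl⟩ := exists_cls v
  exact fiberSum_conj i x.1 ht y

theorem coord_injective {j : ℕ} {v : TBar p n j}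
    (h : ∀ (i : Fin n) (y : Fin n → ZMod p), coord j i y v = 0) : v = 0 := by
  choose g hg hgy using fun y : Fin n → ZMod p => exists_mem_PSub_agree (p := p) (n := n) j y
  let b : Fin n → (Fin n → ZMod p) → TBar p n j := fun i y =>
    if hi : j ≤ i then cls _ (conj_sigma_mem_T hi (g y)) else 0
  let L : TBar p n j →ₗ[ZMod p] TBar p n j :=
    ∑ i, ∑ y ∈ fiber 0 j 0, (coord j i y).smulRight (b i y)
  have hL : L = LinearMap.id := by
    refine LinearMap.ext_on (span_cls_conj_sigma j) ?_
    rintro _ ⟨q, hq, k, hk, rfl⟩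
    have hq0 : q.1 0 ∈ fiber 0 j (0 : Fin n → ZMod p) :=
      mem_fiber.2 ⟨fun k hk => by omega, fun l hl => PSub_apply q hq 0 l hl⟩
    simp only [L, LinearMap.sum_apply, LinearMap.smulRight_apply, coord_cls,
      fiberSum_conj_sigma hk hq, LinearMap.id_apply]
    rw [Finset.sum_eq_single k, Finset.sum_eq_single (q.1 0)]
    · rw [if_pos ⟨rfl, Agree.refl _ _⟩, one_smul]
      simp only [b, dif_pos hk]
      congr 1
      exact conj_sigma_eq hk (hg _) hq (hgy _)
    · intro y hy hne
      rw [if_neg, zero_smul]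
      rintro ⟨-, h1⟩
      refine hne (((eq_trunc h1 (mem_fiber.1 hy).2)).trans ?_)
      exact (eq_trunc (Agree.refl _ _) (mem_fiber.1 hq0).2).symm
    · intro h1
      exact absurd hq0 h1
    · intro i _ hne
      refine Finset.sum_eq_zero fun y _ => ?_
      rw [if_neg (fun h => hne h.1), zero_smul]
    · intro h1
      exact absurd (Finset.mem_univ _) h1
  have : L v = 0 := by simp [L, h]
  rwa [hL] at this

theorem mem_commutator_T {j : ℕ} {t : P p n} (ht : t ∈ T p n j) :
    t ∈ ⁅T p n j, T p n j⁆ ↔ ∀ (i : Fin n) (y : Fin n → ZMod p), fiberSum j i t y = 0 := by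
  rw [← cls_eq_zero_iff ht]
  refine ⟨fun h i y => ?_, fun h => coord_injective fun i y => h i y⟩
  rw [← coord_cls i y ht, h, map_zero]

theorem mem_commutator_iff {g : P p n} :
    g ∈ commutator (P p n) ↔ ∀ i : Fin n, fiberSum 0 i g 0 = 0 := by
  have hg : g ∈ T p n 0 := by rw [T_zero]; trivial
  have h := mem_commutator_T hg
  rw [T_zero] at h
  rw [commutator_def, h]
  exact forall_congr' fun i => ⟨fun h => h 0, fun h y =>
    (fiberSum_congr g fun k hk => absurd hk (Nat.not_lt_zero _)).trans h⟩

theorem fiberSum_zero_mul (i : Fin n) (g h : P p n) :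
    fiberSum 0 i (g * h) 0 = fiberSum 0 i g 0 + fiberSum 0 i h 0 :=
  fiberSum_mul_of_mem_T i (by rw [T_zero]; trivial) (by rw [T_zero]; trivial) 0

/-- The functional on `T_j / T_j'` that is induced by the `i`-th coordinate of `P_n / P_n'`. -/
noncomputable def total (j : ℕ) (i : Fin n) : TBar p n j →ₗ[ZMod p] ZMod p :=
  ∑ y ∈ fiber 0 j 0, coord j i y

theorem total_cls {j : ℕ} (i : Fin n) {t : P p n} (ht : t ∈ T p n j) :
    total j i (cls t ht) = fiberSum 0 i t 0 := by
  simp only [total, LinearMap.sum_apply, coord_cls]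
  rcases lt_or_ge (i : ℕ) j with h | h
  · rw [fiberSum_eq_zero h ht]
    exact Finset.sum_eq_zero fun y _ => fiberSum_eq_zero h ht _ _
  · exact (fiberSum_tower (Nat.zero_le j) t 0).symm

end SylowMaschke

namespace SylowMaschke

section Commutator

variable {p n : ℕ}

/-- `b` moves only points that agree with `z` before the `l`-th coordinate. -/
def SupportedOn (l : ℕ) (z : Fin n → ZMod p) (b : P p n) : Prop :=
  ∀ x, ¬ Agree l x z → b.1 x = x

theorem SupportedOn.conj {l : ℕ} {z : Fin n → ZMod p} {b : P p n} (hb : SupportedOn l z b)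
    (g : P p n) : SupportedOn l (g.1 z) (g * b * g⁻¹) := by
  intro x hx
  rw [mul_apply, mul_apply, hb, apply_inv_apply]
  rwa [agree_inv_apply_iff]

theorem commute_of_disjoint {a b : P p n} (h : ∀ x, a.1 x = x ∨ b.1 x = x) : Commute a b :=
  Subtype.ext (Equiv.Perm.Disjoint.commute (f := a.1) (g := b.1) h)

variable [NeZero p]

/-- The restriction of `u` to the block of `z`, if `u` preserves this block. -/
def restrict (l : ℕ) (z : Fin n → ZMod p) (u : P p n) (hu : Agree l (u.1 z) z) : P p n :=
  ⟨{ toFun := fun x => if Agree l x z then u.1 x else x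
     invFun := fun x => if Agree l x z then u⁻¹.1 x else x
     left_inv := fun x => by
      by_cases h : Agree l x z
      · have : Agree l (u.1 x) z := ((agree_apply_iff u).2 h).trans hu
        simp [h, this]
      · simp [h]
     right_inv := fun x => by
      by_cases h : Agree l x z
      · have : Agree l (u⁻¹.1 x) z := (agree_inv_apply_iff u).2 (h.trans hu.symm)
        simp only [h, this, if_true]
        exact apply_inv_apply u x
      · simp [h] }, by
    rw [mem_P_iff]
    intro i x y hxy
    change (if Agree l x z then u.1 x else x) i - x i = (if Agree l y z then u.1 y else y) i - y i
    rcases le_or_gt l i with hl | hl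
    · by_cases h : Agree l y z
      · rw [if_pos h, if_pos ((hxy.mono hl).trans h)]
        exact triangular_of_mem u i x y hxy
      · rw [if_neg h, if_neg (fun h' => h ((hxy.mono hl).symm.trans h')), sub_self, sub_self]
    · have key : ∀ x, (if Agree l x z then u.1 x else x) i - x i = 0 := by
        intro x
        by_cases h : Agree l x z
        · rw [if_pos h, (((agree_apply_iff u).2 h).trans hu) i hl, h i hl, sub_self]
        · rw [if_neg h, sub_self]
      rw [key, key]⟩

theorem restrict_apply (l : ℕ) (z : Fin n → ZMod p) (u : P p n) (hu : Agree l (u.1 z) z)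
    (x : Fin n → ZMod p) : (restrict l z u hu).1 x = if Agree l x z then u.1 x else x := rfl

variable {N : Subgroup (P p n)} [N.Normal]

/-- If `N` moves the vertex `z` of level `l`, then elements supported below `z` commute modulo `N`
with all elements that fix `z`. -/
theorem commute_mk_of_fix {l : ℕ} {z : Fin n → ZMod p} {g u b : P p n} (hg : g ∈ N)
    (hgz : ¬ Agree l (g.1 z) z) (hu : Agree l (u.1 z) z) (hb : SupportedOn l z b) :
    Commute (QuotientGroup.mk' N u) (QuotientGroup.mk' N b) := by
  set v := restrict l z u hu with hv
  have hvs : SupportedOn l z v := fun x hx => by rw [hv, restrict_apply, if_neg hx]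
  have h1 : Commute (QuotientGroup.mk' N v) (QuotientGroup.mk' N b) := by
    have h2 : QuotientGroup.mk' N (g * v * g⁻¹) = QuotientGroup.mk' N v := by
      have : QuotientGroup.mk' N g = 1 := (QuotientGroup.eq_one_iff g).2 hg
      rw [map_mul, map_mul, map_inv, this, one_mul, inv_one, mul_one]
    rw [← h2]
    refine (commute_of_disjoint fun x => ?_).map _
    by_cases hx : Agree l x z
    · exact Or.inl (hvs.conj g x fun h => hgz (h.symm.trans hx))
    · exact Or.inr (hb x hx)
  have h2 : Commute (v⁻¹ * u) b := commute_of_disjoint fun x => by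
    by_cases hx : Agree l x z
    · left
      have : v.1 x = u.1 x := by rw [hv, restrict_apply, if_pos hx]
      rw [mul_apply, ← this, inv_apply_apply]
    · exact Or.inr (hb x hx)
  have h3 : u = v * (v⁻¹ * u) := by group
  rw [h3, map_mul]
  exact h1.mul_left (h2.map _)

end Commutator

variable {p n : ℕ} [Fact p.Prime]

open scoped commutatorElement in
/-- A normal subgroup of `P_n` that is contained in `T_j` but not in `T_{j+1}` contains `T_j'`. -/
theorem commutator_T_le {j : ℕ} (i₀ : Fin n) (hj : (i₀ : ℕ) = j) {N : Subgroup (P p n)}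
    [hN : N.Normal] (hNT : N ≤ T p n j) {g : P p n} (hg : g ∈ N) {y : Fin n → ZMod p}
    (hy : g.1 y i₀ ≠ y i₀) : ⁅T p n j, T p n j⁆ ≤ N := by
  subst hj
  have hmove : ∀ z : Fin n → ZMod p, ∃ g ∈ N, fiberSum i₀ i₀ g z ≠ 0 := by
    intro z
    obtain ⟨q, -, hq⟩ := exists_mem_PSub_agree (p := p) (n := n) n z
    obtain ⟨q', -, hq'⟩ := exists_mem_PSub_agree (p := p) (n := n) n y
    refine ⟨(q * q'⁻¹) * g * (q * q'⁻¹)⁻¹, hN.conj_mem g hg _, ?_⟩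
    have e : (q * q'⁻¹).1 y = z := by
      have h1 : q'.1 0 = y := funext fun k => hq' k k.2
      have h2 : q.1 0 = z := funext fun k => hq k k.2
      rw [mul_apply, ← h1, inv_apply_apply, h2]
    rw [← e, fiberSum_conj i₀ _ (hNT hg), fiberSum_self]
    exact sub_ne_zero.2 hy
  have hcentral : ∀ (z : Fin n → ZMod p) (a b : P p n), a ∈ T p n i₀ → SupportedOn (i₀ + 1) z b →
      Commute (QuotientGroup.mk' N a) (QuotientGroup.mk' N b) := by
    intro z a b ha hb
    obtain ⟨g, hg, hgz⟩ := hmove z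
    set c : ZMod p := fiberSum i₀ i₀ a z / fiberSum i₀ i₀ g z
    have hu : Agree (i₀ + 1) ((a * (g ^ c.val)⁻¹).1 z) z := by
      have hgm := pow_mem hg c.val
      have hmem : a * (g ^ c.val)⁻¹ ∈ T p n i₀ := mul_mem ha (inv_mem (hNT hgm))
      have h1 := fiberSum_mul_of_mem_T i₀ hmem (hNT hgm) z
      rw [inv_mul_cancel_right, fiberSum_pow i₀ z (hNT hg), ZMod.natCast_zmod_val,
        div_mul_cancel₀ _ hgz, fiberSum_self (g := a * _)] at h1
      intro k hk
      rcases lt_or_eq_of_le (Nat.lt_succ_iff.1 hk) with h | h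
      · exact hmem z k h
      · rw [Fin.ext h]
        linear_combination -h1
    have hgz' : ¬ Agree (i₀ + 1) (g.1 z) z := fun h => hgz (by
      rw [fiberSum_self, h i₀ (Nat.lt_succ_self _), sub_self])
    have h2 := commute_mk_of_fix hg hgz' hu hb
    have h3 : QuotientGroup.mk' N (a * (g ^ c.val)⁻¹) = QuotientGroup.mk' N a := by
      have : QuotientGroup.mk' N (g ^ c.val) = 1 :=
        (QuotientGroup.eq_one_iff _).2 (pow_mem hg c.val)
      rw [map_mul, map_inv, this, inv_one, mul_one]
    rwa [h3] at h2
  have hsupp : ∀ (k : Fin n) (h : P p n), (i₀ : ℕ) + 1 ≤ k → h ∈ PSub p n i₀ →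
      SupportedOn (i₀ + 1) (h.1 0) (h * sigmaP p n k * h⁻¹) := by
    intro k h hk hh x hx
    funext l
    rw [conj_sigma_apply (by omega) hh, if_neg]
    rintro ⟨h1, -⟩
    exact hx (h1.mono hk)
  rw [Subgroup.commutator_le]
  intro a ha b hb
  suffices h : Commute (QuotientGroup.mk' N a) (QuotientGroup.mk' N b) by
    rw [← QuotientGroup.eq_one_iff]
    change QuotientGroup.mk' N ⁅a, b⁆ = 1
    rw [map_commutatorElement, commutatorElement_eq_one_iff_commute]
    exact h
  have hb' := hb
  rw [T_eq_closure] at hb'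
  induction hb' using Subgroup.closure_induction with
  | one => rw [map_one]; exact Commute.one_right _
  | mul c d hc hd ihc ihd =>
    rw [← T_eq_closure] at hc hd
    rw [map_mul]
    exact (ihc hc).mul_right (ihd hd)
  | inv c hc ihc =>
    rw [← T_eq_closure] at hc
    rw [map_inv]
    exact (ihc hc).inv_right
  | mem b hb0 =>
    obtain ⟨h, hh, k, hk, rfl⟩ := hb0
    rcases hk.lt_or_eq with hk' | hk'
    · exact hcentral (h.1 0) _ _ ha (hsupp k h hk' hh)
    · have ha' := ha
      rw [T_eq_closure] at ha'
      induction ha' using Subgroup.closure_induction with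
      | one => rw [map_one]; exact Commute.one_left _
      | mul c d hc hd ihc ihd =>
        rw [← T_eq_closure] at hc hd
        rw [map_mul]
        exact (ihc hc).mul_left (ihd hd)
      | inv c hc ihc =>
        rw [← T_eq_closure] at hc
        rw [map_inv]
        exact (ihc hc).inv_left
      | mem a ha0 =>
        obtain ⟨h', hh', k', hk1, rfl⟩ := ha0
        rcases hk1.lt_or_eq with hk1' | hk1'
        · exact (hcentral (h'.1 0) _ _ hb (hsupp k' h' hk1' hh')).symm
        · obtain rfl : i₀ = k := Fin.ext hk'
          obtain rfl : i₀ = k' := Fin.ext hk1'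
          by_cases he : Agree i₀ (h.1 0) (h'.1 0)
          · rw [conj_sigma_eq le_rfl hh hh' he]
          · refine (commute_of_disjoint fun x => ?_).map _
            by_cases hx : Agree i₀ x (h'.1 0)
            · right
              funext l
              rw [conj_sigma_apply le_rfl hh, if_neg]
              rintro ⟨h1, -⟩
              exact he (h1.symm.trans hx)
            · left
              funext l
              rw [conj_sigma_apply le_rfl hh', if_neg]
              exact fun h1 => hx h1.1

end SylowMaschke

namespace SylowMaschke

section Quotient

variable {p n : ℕ}

/-- The image of `L ∩ T_j` in `T_j / T_j'`. -/
noncomputable def clsSubmodule (j : ℕ) (L : Subgroup (P p n)) : Submodule (ZMod p) (TBar p n j) :=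
  AddSubgroup.toZModSubmodule p
    (Subgroup.toAddSubgroup ((L.subgroupOf (T p n j)).map Abelianization.of))

theorem mem_clsSubmodule {j : ℕ} {L : Subgroup (P p n)} {v : TBar p n j} :
    v ∈ clsSubmodule j L ↔ ∃ (t : P p n) (ht : t ∈ T p n j), t ∈ L ∧ cls t ht = v := by
  constructor
  · intro h
    obtain ⟨t, ht, rfl⟩ := (h : ∃ t ∈ L.subgroupOf (T p n j), Abelianization.of t = v)
    exact ⟨t.1, t.2, ht, rfl⟩
  · rintro ⟨t, ht, hL, rfl⟩
    change ∃ t' ∈ L.subgroupOf (T p n j), Abelianization.of t' = Abelianization.of ⟨t, ht⟩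
    exact ⟨⟨t, ht⟩, hL, rfl⟩

theorem exists_isCompl_iff (j : ℕ) (N : Subgroup (P p n)) [N.Normal] :
    (∃ D : Submodule (MonoidAlgebra (ZMod p) (PSub p n j)) (rep p n j).asModule,
      IsCompl (NBar p n j N).asSubmodule D) ↔
    ∃ D : Submodule (ZMod p) (TBar p n j), (∀ x, ∀ v ∈ D, rep p n j x v ∈ D) ∧
      IsCompl (clsSubmodule j N) D := by
  have key : ∀ D : Subrepresentation (rep p n j), IsCompl (NBar p n j N) D ↔
      IsCompl (clsSubmodule j N) D.toSubmodule := by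
    intro D
    rw [isCompl_iff, isCompl_iff, disjoint_iff, disjoint_iff, codisjoint_iff, codisjoint_iff,
      ← Subrepresentation.toSubmodule_injective.eq_iff,
      ← Subrepresentation.toSubmodule_injective.eq_iff]
    rfl
  constructor
  · rintro ⟨D, hD⟩
    have h := (OrderIso.isCompl_iff
      (Subrepresentation.subrepresentationSubmoduleOrderIso (ρ := rep p n j)).symm).1 hD
    exact ⟨_, fun x v hv => (Subrepresentation.ofSubmodule' D).apply_mem_toSubmodule x hv,
      (key _).1 h⟩
  · rintro ⟨D, hst, hD⟩
    have h := (key ⟨D, fun x v hv => hst x v hv⟩).2 hD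
    exact ⟨_, (OrderIso.isCompl_iff
      (Subrepresentation.subrepresentationSubmoduleOrderIso (ρ := rep p n j))).1 h⟩

theorem cls_congr {j : ℕ} {s t : P p n} (h : s = t) (hs : s ∈ T p n j) :
    cls s hs = cls t (h ▸ hs) := by
  subst h
  rfl

theorem cls_conj {j : ℕ} {s t : P p n} (hs : s ∈ T p n j) (ht : t ∈ T p n j) :
    cls (s * t * s⁻¹) ((T_normal p n j).conj_mem t ht s) = cls t ht := by
  have h1 : cls (s * t * s⁻¹) ((T_normal p n j).conj_mem t ht s) =
      cls s hs + cls t ht + -cls s hs := rfl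
  rw [h1]
  abel

theorem cls_eq_cls_iff {j : ℕ} {s t : P p n} (hs : s ∈ T p n j) (ht : t ∈ T p n j) :
    cls s hs = cls t ht ↔ s⁻¹ * t ∈ ⁅T p n j, T p n j⁆ := by
  rw [← cls_eq_zero_iff (mul_mem (inv_mem hs) ht)]
  have : cls (s⁻¹ * t) (mul_mem (inv_mem hs) ht) = -cls s hs + cls t ht := rfl
  rw [this, neg_add_eq_zero]

theorem exists_mul_of_isComplement' {N C : Subgroup (P p n)} (h : Subgroup.IsComplement' N C)
    (g : P p n) : ∃ a ∈ N, ∃ c ∈ C, g = a * c := by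
  obtain ⟨x, hx⟩ := h.2 g
  exact ⟨x.1, x.1.2, x.2, x.2.2, hx.symm⟩

theorem eq_one_of_isComplement' {N C : Subgroup (P p n)} (h : Subgroup.IsComplement' N C)
    {g : P p n} (hN : g ∈ N) (hC : g ∈ C) : g = 1 :=
  Subgroup.disjoint_def.1 h.disjoint hN hC

theorem exists_isCompl_of_isComplement' {j : ℕ} {N C : Subgroup (P p n)} [N.Normal]
    (hNT : N ≤ T p n j) (hK : ⁅T p n j, T p n j⁆ ≤ N) (hC : Subgroup.IsComplement' N C) :
    ∃ D : Submodule (ZMod p) (TBar p n j), (∀ x, ∀ v ∈ D, rep p n j x v ∈ D) ∧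
      IsCompl (clsSubmodule j N) D := by
  refine ⟨clsSubmodule j C, fun x v hv => ?_, ?_⟩
  · obtain ⟨t, ht, htC, rfl⟩ := mem_clsSubmodule.1 hv
    obtain ⟨a, ha, c, hc, e⟩ := exists_mul_of_isComplement' hC x
    have hct := (T_normal p n j).conj_mem t ht c
    refine mem_clsSubmodule.2 ⟨c * t * c⁻¹, hct, mul_mem (mul_mem hc htC) (inv_mem hc), ?_⟩
    rw [rep_cls, ← cls_conj (hNT ha) hct]
    refine cls_congr ?_ _
    rw [e]
    group
  · refine IsCompl.of_eq ?_ ?_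
    · rw [Submodule.eq_bot_iff]
      rintro v ⟨h1, h2⟩
      obtain ⟨a, ha, haN, rfl⟩ := mem_clsSubmodule.1 h1
      obtain ⟨c, hc, hcC, e⟩ := mem_clsSubmodule.1 h2
      have h3 := (cls_eq_cls_iff ha hc).1 e.symm
      have h4 : c ∈ N := by
        have := mul_mem haN (hK h3)
        rwa [mul_inv_cancel_left] at this
      rw [← e, cls_eq_zero_iff, eq_one_of_isComplement' hC h4 hcC]
      exact one_mem _
    · rw [eq_top_iff]
      rintro v -
      obtain ⟨t, ht, rfl⟩ := exists_cls v
      obtain ⟨a, ha, c, hc, rfl⟩ := exists_mul_of_isComplement' hC t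
      have hcT : c ∈ T p n j := by
        have := mul_mem (inv_mem (hNT ha)) ht
        rwa [inv_mul_cancel_left] at this
      exact add_mem (Submodule.mem_sup_left (mem_clsSubmodule.2 ⟨a, hNT ha, ha, rfl⟩))
        (Submodule.mem_sup_right (mem_clsSubmodule.2 ⟨c, hcT, hc, rfl⟩))

end Quotient

variable {p n : ℕ} [Fact p.Prime]

theorem sum_fiber_succ (i₀ : Fin n) (y : Fin n → ZMod p) (F : (Fin n → ZMod p) → ZMod p)
    (hF : ∀ x x', Agree (i₀ + 1) x x' → F x = F x') :
    ∑ z ∈ fiber i₀ (i₀ + 1) y, F z = ∑ s, F (Function.update y i₀ s) := by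
  have h0 : ∀ s, Agree i₀ (Function.update y i₀ s) y := fun s k hk =>
    Function.update_of_ne (by rintro rfl; omega) _ _
  have h1 : ∀ z, Agree i₀ z y → Agree (i₀ + 1) (Function.update y i₀ (z i₀)) z := by
    intro z hz k hk
    by_cases hki : k = i₀
    · subst hki; simp
    · rw [Function.update_of_ne hki, hz k]
      have : (k : ℕ) ≠ i₀ := fun h => hki (Fin.ext h)
      omega
  refine Finset.sum_nbij' (fun z => z i₀) (fun s => trunc (i₀ + 1) (Function.update y i₀ s))
    ?_ ?_ ?_ ?_ ?_
  · intro z _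
    exact Finset.mem_univ _
  · intro s _
    exact mem_fiber.2 ⟨((trunc_agree _ _).mono (Nat.le_succ _)).trans (h0 s),
      fun k hk => trunc_of_le _ hk⟩
  · intro z hz
    rw [mem_fiber] at hz
    exact (eq_trunc (h1 z hz.1).symm hz.2).symm
  · intro s _
    rw [trunc_agree _ _ i₀ (Nat.lt_succ_self _)]
    simp
  · intro z hz
    exact hF _ _ (h1 z (mem_fiber.1 hz).1).symm

/-- If `d` moves the vertex `y` of level `i₀`, then the elements of `T_{i₀}` that commute with `d`
have coordinates at `y` proportional to those of `d`. -/
theorem exists_fiberSum_eq_mul_of_commute (i₀ : Fin n) {d t : P p n} (hd : d ∈ T p n i₀)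
    (ht : t ∈ T p n i₀) (hcomm : Commute t d) {y : Fin n → ZMod p}
    (hy : fiberSum i₀ i₀ d y ≠ 0) :
    ∃ c : ZMod p, ∀ i : Fin n, fiberSum i₀ i t y = c * fiberSum i₀ i d y := by
  have key : ∀ u ∈ T p n i₀, Commute u d → fiberSum i₀ i₀ u y = 0 →
      ∀ i : Fin n, fiberSum i₀ i u y = 0 := by
    intro u hu hud hu0 i
    rcases lt_trichotomy i i₀ with hi | rfl | hi
    · exact fiberSum_eq_zero (Fin.lt_def.1 hi) hu _ _
    · exact hu0
    have hi' : (i₀ : ℕ) + 1 ≤ i := Fin.lt_def.1 hi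
    set F : ZMod p → ZMod p := fun s => fiberSum (i₀ + 1) i u (Function.update y i₀ s) with hF
    set c := fiberSum i₀ i₀ d y with hc
    have h0 : ∀ s, Agree i₀ (Function.update y i₀ s) y := fun s k hk =>
      Function.update_of_ne (by rintro rfl; omega) _ _
    have hshift : ∀ s, F (s + c) = F s := by
      intro s
      set z := Function.update y i₀ s with hz
      have hdz : Agree (i₀ + 1) (d.1 z) (Function.update y i₀ (s + c)) := by
        intro k hk
        by_cases hki : k = i₀
        · subst hki
          have h1 := triangular_of_mem d k _ _ (h0 s)
          rw [← hz, ← fiberSum_self k d y, ← hc] at h1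
          have h2 : z k = s := by simp [hz]
          rw [Function.update_self]
          linear_combination h1 + h2
        · have hk' : (k : ℕ) < i₀ := by
            have : (k : ℕ) ≠ i₀ := fun h => hki (Fin.ext h)
            omega
          rw [hd z k hk', hz, h0 s k hk', Function.update_of_ne hki]
      have huz : Agree (i₀ + 1) (u.1 z) z := by
        intro k hk
        by_cases hki : k = i₀
        · subst hki
          have h1 := triangular_of_mem u k _ _ (h0 s)
          rw [← fiberSum_self k u y, hu0] at h1
          exact sub_eq_zero.1 h1
        · have hk' : (k : ℕ) < i₀ := by
            have : (k : ℕ) ≠ i₀ := fun h => hki (Fin.ext h)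
            omega
          exact hu z k hk'
      have h1 := fiberSum_mul hi' u d z
      have h2 := fiberSum_mul hi' d u z
      rw [← hud.eq, fiberSum_congr d huz, h1, fiberSum_congr u hdz] at h2
      change F (s + c) + _ = _ + F s at h2
      linear_combination h2
    have hmul : ∀ m : ℕ, F (m * c) = F 0 := by
      intro m
      induction m with
      | zero => simp
      | succ m ih => rw [← ih, ← hshift (m * c)]; congr 1; push_cast; ring
    have hconst : ∀ s, F s = F 0 := by
      intro s
      rw [← hmul (s / c).val, ZMod.natCast_zmod_val, div_mul_cancel₀ _ hy]
    rw [fiberSum_tower (Nat.le_succ i₀) u y, sum_fiber_succ i₀ y (fiberSum (i₀ + 1) i u)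
      fun x x' h => fiberSum_congr u h]
    change ∑ s, F s = 0
    rw [Finset.sum_congr rfl fun s _ => hconst s, Finset.sum_const, Finset.card_univ, ZMod.card,
      nsmul_eq_mul, ZMod.natCast_self, zero_mul]
  set c := fiberSum i₀ i₀ t y / fiberSum i₀ i₀ d y with hc
  have hdm := pow_mem hd c.val
  have hu := mul_mem ht (inv_mem hdm)
  have hval : ∀ i, fiberSum i₀ i t y =
      fiberSum i₀ i (t * (d ^ c.val)⁻¹) y + c * fiberSum i₀ i d y := by
    intro i
    have h1 := fiberSum_mul_of_mem_T i hu hdm y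
    rwa [inv_mul_cancel_right, fiberSum_pow i y hd, ZMod.natCast_zmod_val] at h1
  have hu0 : fiberSum i₀ i₀ (t * (d ^ c.val)⁻¹) y = 0 := by
    have := hval i₀
    rw [hc, div_mul_cancel₀ _ hy] at this
    linear_combination -this
  refine ⟨c, fun i => ?_⟩
  rw [hval i, key _ hu (hcomm.mul_left ((Commute.refl d).pow_left _).inv_left) hu0 i, zero_add]

theorem fiberSum_zero_sigma (k i : Fin n) :
    fiberSum 0 i (sigmaP p n k) 0 = if i = k then 1 else 0 := by
  have h := fiberSum_conj_sigma (p := p) (Nat.zero_le k) (one_mem (PSub p n 0)) i 0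
  rw [one_mul, inv_one, mul_one] at h
  rw [h]
  exact if_congr (and_iff_left (Agree.refl 0 0)) rfl rfl

theorem mem_map_mk_commutator {L : Subgroup (P p n)} {g : P p n} :
    QuotientGroup.mk' (commutator (P p n)) g ∈ L.map (QuotientGroup.mk' (commutator (P p n))) ↔
      ∃ l ∈ L, ∀ i : Fin n, fiberSum 0 i l 0 = fiberSum 0 i g 0 := by
  rw [Subgroup.mem_map]
  refine exists_congr fun l => and_congr_right fun _ => ?_
  change (l : P p n ⧸ commutator (P p n)) = g ↔ _
  rw [QuotientGroup.eq, mem_commutator_iff]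
  refine forall_congr' fun i => ?_
  have h := fiberSum_zero_mul i l (l⁻¹ * g)
  rw [mul_inv_cancel_left] at h
  rw [h]
  constructor
  · intro h; rw [h, add_zero]
  · intro h; linear_combination -h

open scoped commutatorElement in
theorem not_map_lt_of_isComplement' (i₀ : Fin n) {N C : Subgroup (P p n)} [N.Normal]
    (hNT : N ≤ T p n i₀) (hK : ⁅T p n i₀, T p n i₀⁆ ≤ N) (hC : Subgroup.IsComplement' N C) :
    ¬ (N.map (QuotientGroup.mk' (commutator (P p n))) <
      (T p n (i₀ + 1)).map (QuotientGroup.mk' (commutator (P p n)))) := by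
  intro hlt
  have hN0 : ∀ a ∈ N, fiberSum 0 i₀ a 0 = 0 := by
    intro a ha
    obtain ⟨t, ht, h⟩ := mem_map_mk_commutator.1 (hlt.le ⟨a, ha, rfl⟩)
    rw [← h i₀, fiberSum_eq_zero (Nat.lt_succ_self _) ht]
  have hfac : ∀ t ∈ T p n i₀, ∃ a ∈ N, ∃ d ∈ C, d ∈ T p n i₀ ∧ t = a * d := by
    intro t ht
    obtain ⟨a, ha, c, hc, rfl⟩ := exists_mul_of_isComplement' hC t
    refine ⟨a, ha, c, hc, ?_, rfl⟩
    have := mul_mem (inv_mem (hNT ha)) ht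
    rwa [inv_mul_cancel_left] at this
  have hsum : ∀ t ∈ T p n i₀, ∀ i : Fin n, i₀ ≤ i →
      fiberSum 0 i t 0 = ∑ y ∈ fiber 0 i₀ 0, fiberSum i₀ i t y :=
    fun t _ i _ => fiberSum_tower (Nat.zero_le _) t 0
  obtain ⟨a₀, ha₀, d, hdC, hd, hσ⟩ := hfac _ (sigmaP_mem_T i₀ le_rfl)
  have hd0 : fiberSum 0 i₀ d 0 ≠ 0 := by
    have h := fiberSum_zero_sigma (p := p) i₀ i₀
    rw [hσ, fiberSum_zero_mul, hN0 a₀ ha₀, zero_add, if_pos rfl] at h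
    rw [h]
    exact one_ne_zero
  obtain ⟨y, -, hy⟩ : ∃ y ∈ fiber 0 i₀ 0, fiberSum i₀ i₀ d y ≠ 0 := by
    rw [hsum d hd i₀ le_rfl] at hd0
    exact Finset.exists_ne_zero_of_sum_ne_zero hd0
  have hcomm : ∀ a ∈ C, a ∈ T p n i₀ → Commute a d := by
    intro a ha haT
    rw [← commutatorElement_eq_one_iff_commute]
    refine eq_one_of_isComplement' hC (hK (Subgroup.commutator_mem_commutator haT hd)) ?_
    rw [commutatorElement_def]
    exact mul_mem (mul_mem (mul_mem ha hdC) (inv_mem ha)) (inv_mem hdC)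
  have hline : ∀ a ∈ C, a ∈ T p n i₀ → ∀ x : Fin n → ZMod p, ∃ c : ZMod p, ∀ i : Fin n,
      fiberSum i₀ i a x = c * fiberSum i₀ i d y := by
    intro a ha haT x
    obtain ⟨q, -, hq⟩ := exists_mem_PSub_agree (p := p) (n := n) i₀ x
    obtain ⟨q', -, hq'⟩ := exists_mem_PSub_agree (p := p) (n := n) i₀ y
    obtain ⟨b, hb, c, hc, e⟩ := exists_mul_of_isComplement' hC (q' * q⁻¹)
    have hcx : Agree i₀ (c.1 x) y := by
      have h1 : Agree i₀ ((q' * q⁻¹).1 x) y := by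
        refine Agree.trans ?_ hq'
        rw [mul_apply, agree_apply_iff, agree_inv_apply_iff]
        exact hq.symm
      rw [e, mul_apply] at h1
      exact (agree_of_mem_T (hNT hb) _).symm.trans h1
    obtain ⟨l, hl⟩ := exists_fiberSum_eq_mul_of_commute i₀ hd
      ((T_normal p n i₀).conj_mem a haT c)
      (hcomm _ (mul_mem (mul_mem hc ha) (inv_mem hc)) ((T_normal p n i₀).conj_mem a haT c)) hy
    refine ⟨l, fun i => ?_⟩
    rw [← hl i, ← fiberSum_conj i c haT x]
    exact fiberSum_congr _ hcx
  refine hlt.not_ge ?_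
  rintro _ ⟨t, ht, rfl⟩
  have ht' : t ∈ T p n i₀ := fun x k hk => ht x k (hk.trans (Nat.lt_succ_self _))
  obtain ⟨a, ha, b, hb, hbT, rfl⟩ := hfac t ht'
  refine mem_map_mk_commutator.2 ⟨a, ha, fun i => ?_⟩
  rw [fiberSum_zero_mul]
  suffices h : fiberSum 0 i b 0 = 0 by rw [h, add_zero]
  choose l hl using hline b hb hbT
  have hb' : ∀ i : Fin n, i₀ ≤ i →
      fiberSum 0 i b 0 = (∑ x ∈ fiber 0 i₀ 0, l x) * fiberSum i₀ i d y := by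
    intro i hi
    rw [hsum b hbT i hi, Finset.sum_mul]
    exact Finset.sum_congr rfl fun x _ => hl x i
  have hb0 : fiberSum 0 i₀ b 0 = 0 := by
    have h := fiberSum_eq_zero (Nat.lt_succ_self _) ht 0 0
    rwa [fiberSum_zero_mul, hN0 a ha, zero_add] at h
  rcases lt_or_ge i i₀ with hi | hi
  · exact fiberSum_eq_zero (Fin.lt_def.1 hi) hbT _ _
  · rw [hb' i₀ le_rfl] at hb0
    rw [hb' i hi, (mul_eq_zero.1 hb0).resolve_right hy, zero_mul]

end SylowMaschke

namespace SylowMaschke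

/-- A representation of a `p`-group over `𝔽_p` has a nonzero fixed vector in every nonzero finite
stable subspace. -/
theorem exists_fixed_ne_zero {p : ℕ} [Fact p.Prime] {G V : Type*} [Group G] (hG : IsPGroup p G)
    [AddCommGroup V] [Module (ZMod p) V] [Finite V] (ρ : Representation (ZMod p) G V)
    (U : Submodule (ZMod p) V) (hU : ∀ g, ∀ v ∈ U, ρ g v ∈ U) (hne : U ≠ ⊥) :
    ∃ v ∈ U, v ≠ 0 ∧ ∀ g, ρ g v = v := by
  let _ : MulAction G U :=
    { smul := fun g v => ⟨ρ g v.1, hU g v.1 v.2⟩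
      one_smul := fun v => Subtype.ext (by change ρ 1 v.1 = v.1; rw [map_one]; rfl)
      mul_smul := fun g h v => Subtype.ext (by
        change ρ (g * h) v.1 = ρ g (ρ h v.1); rw [map_mul]; rfl) }
  obtain ⟨w, hw, hw0⟩ := (Submodule.ne_bot_iff U).1 hne
  have hcard : p ∣ Nat.card U := by
    have h1 : addOrderOf (⟨w, hw⟩ : U) = p := by
      refine addOrderOf_eq_prime ?_ fun h => hw0 (congrArg Subtype.val h)
      rw [← Nat.cast_smul_eq_nsmul (ZMod p), ZMod.natCast_self, zero_smul]
    exact h1.symm.dvd.trans (addOrderOf_dvd_natCard _)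
  have h0 : (0 : U) ∈ MulAction.fixedPoints G U := fun g => Subtype.ext (map_zero (ρ g))
  obtain ⟨b, hb, hb0⟩ := hG.exists_fixed_point_of_prime_dvd_card_of_fixed_point U hcard h0
  exact ⟨b.1, b.2, fun h => hb0 (Subtype.ext h.symm), fun g => congrArg Subtype.val (hb g)⟩

variable {p n : ℕ} [Fact p.Prime]

theorem pow_mem_T_succ {j : ℕ} {g : P p n} (hg : g ∈ T p n j) : g ^ p ∈ T p n (j + 1) := by
  intro x k hk
  rcases lt_or_eq_of_le (Nat.lt_succ_iff.1 hk) with h | h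
  · exact pow_mem hg p x k h
  · subst h
    have h1 := fiberSum_pow k x hg p
    rw [ZMod.natCast_self, zero_mul, fiberSum_self] at h1
    exact sub_eq_zero.1 h1

theorem isPGroup_P : IsPGroup p (P p n) := by
  intro g
  have key : ∀ j, g ^ p ^ j ∈ T p n j := by
    intro j
    induction j with
    | zero => rw [T_zero]; trivial
    | succ j ih => rw [pow_succ, pow_mul]; exact pow_mem_T_succ ih
  have h := key n
  rw [T_self] at h
  exact ⟨n, h⟩

instance (j : ℕ) : Finite (TBar p n j) :=
  inferInstanceAs (Finite (Additive (Abelianization (T p n j))))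

/-- The translation `x ↦ x + z` for a point `z` that vanishes from the `j`-th coordinate on. -/
def translation (j : ℕ) (z : Fin n → ZMod p) : PSub p n j :=
  ⟨⟨Equiv.addRight (trunc j z), mem_P_iff.2 fun i x y _ => by simp⟩,
    mem_PSub_iff.2 fun x k hk => by
      change (x + trunc j z) k = x k
      rw [Pi.add_apply, trunc_of_le z hk, add_zero]⟩

theorem translation_apply (j : ℕ) (z x : Fin n → ZMod p) :
    (translation j z).1.1 x = x + trunc j z := rfl

/-- The sum of the translates of a vector of `T_j / T_j'`. -/
noncomputable def translationSum (j : ℕ) : TBar p n j →ₗ[ZMod p] TBar p n j :=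
  ∑ z ∈ fiber 0 j 0, rep p n j (translation j z)

theorem coord_translationSum {j : ℕ} (i : Fin n) (y : Fin n → ZMod p) (v : TBar p n j) :
    coord j i y (translationSum j v) = total j i v := by
  have h1 : ∀ z, coord j i y (rep p n j (translation j z) v) = coord j i (y - trunc j z) v := by
    intro z
    rw [← coord_rep i (translation j z) (y - trunc j z) v, translation_apply, sub_add_cancel]
  simp only [translationSum, total, LinearMap.sum_apply, map_sum, h1]
  have hinv : ∀ z ∈ fiber 0 j (0 : Fin n → ZMod p),
      trunc j (y - trunc j (trunc j (y - trunc j z))) = z := by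
    intro z hz
    refine (eq_trunc (fun k hk => ?_) (mem_fiber.1 hz).2).symm
    simp [trunc, hk]
  have hmem : ∀ z : Fin n → ZMod p, trunc j z ∈ fiber 0 j (0 : Fin n → ZMod p) := fun z =>
    mem_fiber.2 ⟨fun k hk => absurd hk (Nat.not_lt_zero _), fun k hk => trunc_of_le _ hk⟩
  refine Finset.sum_nbij' (fun z => trunc j (y - trunc j z)) (fun z => trunc j (y - trunc j z))
    (fun z _ => hmem _) (fun z _ => hmem _) hinv hinv fun z _ => ?_
  exact coord_congr i (trunc_agree _ _).symm v

theorem exists_total_eq (j : ℕ) (c : Fin n → ZMod p) (hc : ∀ i : Fin n, (i : ℕ) < j → c i = 0) :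
    ∃ v : TBar p n j, ∀ i, total j i v = c i := by
  refine ⟨∑ k, c k • if hk : j ≤ k then cls _ (sigmaP_mem_T k hk) else 0, fun i => ?_⟩
  simp only [map_sum, map_smul]
  rw [Finset.sum_eq_single i]
  · rcases lt_or_ge (i : ℕ) j with h | h
    · rw [hc i h, zero_smul]
    · rw [dif_pos h, total_cls, fiberSum_zero_sigma, if_pos rfl, smul_eq_mul, mul_one]
  · intro k _ hki
    by_cases hk : j ≤ k
    · rw [dif_pos hk, total_cls, fiberSum_zero_sigma, if_neg (Ne.symm hki), smul_zero]
    · rw [dif_neg hk, map_zero, smul_zero]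
  · intro h
    exact absurd (Finset.mem_univ _) h

theorem coord_eq_zero_of_lt {j : ℕ} {i : Fin n} (hi : (i : ℕ) < j) (y : Fin n → ZMod p)
    (v : TBar p n j) : coord j i y v = 0 := by
  obtain ⟨t, ht, rfl⟩ := exists_cls v
  exact fiberSum_eq_zero hi ht _ _

/-- The fixed vectors in a direct summand `M` of `T_j / T_j'` are the constant vectors whose entries
are the totals of an element of `M`. -/
theorem exists_total_eq_coord_of_fixed {j : ℕ} {M D : Submodule (ZMod p) (TBar p n j)}
    (hM : ∀ x, ∀ v ∈ M, rep p n j x v ∈ M) (hD : ∀ x, ∀ v ∈ D, rep p n j x v ∈ D)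
    (hMD : IsCompl M D) {v : TBar p n j} (hv : v ∈ M) (hfix : ∀ x, rep p n j x v = v) :
    ∃ a ∈ M, ∀ i y, total j i a = coord j i y v := by
  have hconst : ∀ i y, coord j i y v = coord j i 0 v := by
    intro i y
    obtain ⟨q, hq, hqy⟩ := exists_mem_PSub_agree (p := p) (n := n) j y
    have h := coord_rep i ⟨q, hq⟩ 0 v
    rw [hfix] at h
    rw [← h]
    exact coord_congr i hqy.symm v
  obtain ⟨w, hw⟩ := exists_total_eq j (fun i => coord j i 0 v)
    fun i hi => coord_eq_zero_of_lt hi 0 v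
  have hνw : translationSum j w = v := by
    rw [← sub_eq_zero]
    refine coord_injective fun i y => ?_
    rw [map_sub, coord_translationSum, hw, hconst i y, sub_self]
  have hst : ∀ U : Submodule (ZMod p) (TBar p n j), (∀ x, ∀ v ∈ U, rep p n j x v ∈ U) →
      ∀ u ∈ U, translationSum j u ∈ U := by
    intro U hU u hu
    simp only [translationSum, LinearMap.sum_apply]
    exact Submodule.sum_mem _ fun z _ => hU _ _ hu
  obtain ⟨a, ha, b, hb, hab⟩ := Submodule.mem_sup.1
    ((hMD.sup_eq_top ▸ Submodule.mem_top : w ∈ M ⊔ D))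
  have hνb : translationSum j b = 0 := by
    refine Submodule.disjoint_def.1 hMD.disjoint _ ?_ (hst D hD b hb)
    have : translationSum j b = v - translationSum j a := by
      rw [← hνw, ← hab, map_add, add_sub_cancel_left]
    rw [this]
    exact sub_mem hv (hst M hM a ha)
  refine ⟨a, ha, fun i y => ?_⟩
  have hb0 : total j i b = 0 := by
    rw [← coord_translationSum i y, hνb, map_zero]
  rw [hconst, ← hw i, ← hab, map_add, hb0, add_zero]

/-- A stable subspace of `T_j / T_j'` on which the totals satisfy no linear relation is the whole
space. -/
theorem eq_top_of_total {j : ℕ} {M : Submodule (ZMod p) (TBar p n j)}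
    (hM : ∀ x, ∀ v ∈ M, rep p n j x v ∈ M)
    (h : ∀ a : Fin n → ZMod p, (∀ v ∈ M, ∑ i, a i * total j i v = 0) →
      ∀ i : Fin n, j ≤ i → a i = 0) : M = ⊤ := by
  by_contra hne
  have hfin : Finite (Module.Dual (ZMod p) (TBar p n j)) := DFunLike.finite _
  have hbot : M.dualAnnihilator ≠ ⊥ := by
    obtain ⟨φ, hφ, hM'⟩ := Submodule.exists_le_ker_of_lt_top M (lt_top_iff_ne_top.2 hne)
    rw [Submodule.ne_bot_iff]
    exact ⟨φ, (Submodule.mem_dualAnnihilator φ).2 fun v hv => hM' hv, hφ⟩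
  obtain ⟨φ, hφM, hφ0, hfix⟩ := exists_fixed_ne_zero (isPGroup_P.to_subgroup (PSub p n j))
    (rep p n j).dual M.dualAnnihilator (fun g φ hφ => by
      rw [Submodule.mem_dualAnnihilator] at hφ ⊢
      exact fun v hv => hφ _ (hM g⁻¹ v hv)) hbot
  rw [Submodule.mem_dualAnnihilator] at hφM
  have hinv : ∀ x v, φ (rep p n j x v) = φ v := by
    intro x v
    have h1 := LinearMap.congr_fun (hfix x⁻¹) v
    have h2 : (rep p n j).dual x⁻¹ φ v = φ (rep p n j x⁻¹⁻¹ v) := rfl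
    rwa [h2, inv_inv] at h1
  let a : Fin n → ZMod p := fun i => if hi : j ≤ i then φ (cls _ (sigmaP_mem_T i hi)) else 0
  have hφa : φ = ∑ i, a i • total j i := by
    refine LinearMap.ext_on (span_cls_conj_sigma j) ?_
    rintro _ ⟨q, hq, k, hk, rfl⟩
    have h1 : φ (cls _ (conj_sigma_mem_T hk q)) = a k := by
      simp only [a, dif_pos hk]
      exact hinv ⟨q, hq⟩ (cls _ (sigmaP_mem_T k hk))
    have h2 : ∀ i, total j i (cls _ (conj_sigma_mem_T hk q)) = if i = k then 1 else 0 := by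
      intro i
      rw [total_cls, ← fiberSum_zero_sigma (p := p) k i,
        ← fiberSum_conj (j := 0) i q (t := sigmaP p n k) (by rw [T_zero]; trivial) 0]
      exact fiberSum_congr _ fun l hl => absurd hl (Nat.not_lt_zero _)
    rw [h1]
    simp [h2]
  have ha : ∀ i, a i = 0 := by
    intro i
    by_cases hi : j ≤ i
    · refine h a (fun v hv => ?_) i hi
      rw [← hφM v hv, hφa]
      simp
    · simp only [a, dif_neg hi]
  exact hφ0 (by rw [hφa]; simp [ha])

end SylowMaschke

namespace SylowMaschke

/-- Functions `χ_i` on `𝔽_p^n` with disjoint supports, such that `χ_i` depends only on the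
coordinates from the `j`-th one to the one before the `i`-th one, and is invariant under rescaling
coordinates. For functions `u_i` on `𝔽_p^j`, the maps that add `χ_i u_i` to each coordinate `i` form
an abelian subgroup of `T_j`. -/
structure Mask (p n j : ℕ) [NeZero p] where
  /-- The functions `χ_i`. -/
  val : Fin n → (Fin n → ZMod p) → ZMod p
  /-- The sum of `χ_i` over the vertices of level `i` below a vertex of level `j`. -/
  weight : Fin n → ZMod p
  congr : ∀ (i : Fin n) x y, Agree i x y → val i x = val i y
  congr_of_ge : ∀ i x y, (∀ k : Fin n, j ≤ k → x k = y k) → val i x = val i y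
  eq_of_ne_zero : ∀ i k x, val i x ≠ 0 → val k x ≠ 0 → i = k
  le_of_ne_zero : ∀ i x, val i x ≠ 0 → j ≤ i
  val_eta : ∀ (r : (ZMod p)ˣ) k i x, val i (eta r k x) = val i x
  sum_val : ∀ (i : Fin n) y, ∑ x ∈ fiber j i y, val i x = weight i
  val_eq_zero : ∀ i x, weight i = 0 → val i x = 0

/-- The families `u_i` of functions on `𝔽_p^n` that only depend on the first `j` coordinates. -/
def LevelFun (p n j : ℕ) : AddSubgroup (Fin n → (Fin n → ZMod p) → ZMod p) where
  carrier := {u | ∀ i x y, Agree j x y → u i x = u i y}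
  zero_mem' _ _ _ _ := rfl
  add_mem' hu hv i x y h := congrArg₂ (· + ·) (hu i x y h) (hv i x y h)
  neg_mem' hu i x y h := congrArg Neg.neg (hu i x y h)

namespace Mask

variable {p n j : ℕ} [NeZero p] (m : Mask p n j)

/-- The map that adds `χ_i u_i` to each coordinate `i`. -/
def map (u : Fin n → (Fin n → ZMod p) → ZMod p) (x : Fin n → ZMod p) : Fin n → ZMod p :=
  fun i => x i + m.val i x * u i x

theorem agree_map (u : Fin n → (Fin n → ZMod p) → ZMod p) (x : Fin n → ZMod p) :
    Agree j (m.map u x) x := by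
  intro k hk
  have : m.val k x = 0 := by
    by_contra h
    exact absurd (m.le_of_ne_zero k x h) (not_le.2 hk)
  simp [map, this]

theorem val_map (u : Fin n → (Fin n → ZMod p) → ZMod p) (x : Fin n → ZMod p) (i : Fin n) :
    m.val i (m.map u x) = m.val i x := by
  have key : ∀ i, m.val i x ≠ 0 → m.val i (m.map u x) = m.val i x := by
    intro i hi
    refine m.congr i _ _ fun k hk => ?_
    have : m.val k x = 0 := by
      by_contra h
      have := m.eq_of_ne_zero i k x hi h
      subst this
      omega
    simp [map, this]
  by_cases hi : m.val i x = 0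
  · by_cases hall : ∀ k, m.val k x = 0
    · have : m.map u x = x := funext fun k => by simp [map, hall]
      rw [this]
    · push Not at hall
      obtain ⟨k, hk⟩ := hall
      have hk' := key k hk
      by_contra h
      rw [hi] at h
      have := m.eq_of_ne_zero i k _ h (hk'.trans_ne hk)
      exact hk (this ▸ hi)
  · exact key i hi

theorem map_map {u v : Fin n → (Fin n → ZMod p) → ZMod p} (hu : u ∈ LevelFun p n j)
    (x : Fin n → ZMod p) : m.map u (m.map v x) = m.map (u + v) x := by
  funext i
  have h1 : u i (m.map v x) = u i x := hu i _ _ (m.agree_map v x)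
  have h2 : m.map v x i = x i + m.val i x * v i x := rfl
  change m.map v x i + m.val i (m.map v x) * u i (m.map v x) = x i + m.val i x * (u i x + v i x)
  rw [m.val_map, h1, h2]
  ring

/-- The homomorphism `u ↦ map u` to `P_n`. -/
def hom : Multiplicative (LevelFun p n j) →* P p n where
  toFun u :=
    ⟨{ toFun := m.map u.toAdd.1
       invFun := m.map (-u.toAdd.1)
       left_inv := fun x => by
        rw [m.map_map (neg_mem u.toAdd.2), neg_add_cancel]
        funext i; simp [map]
       right_inv := fun x => by
        rw [m.map_map u.toAdd.2, add_neg_cancel]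
        funext i; simp [map] }, by
      rw [mem_P_iff]
      intro i x y hxy
      have h1 : m.val i x * u.toAdd.1 i x = m.val i y * u.toAdd.1 i y := by
        rw [m.congr i x y hxy]
        by_cases h : m.val i y = 0
        · rw [h, zero_mul, zero_mul]
        · rw [u.toAdd.2 i x y (hxy.mono (m.le_of_ne_zero i y h))]
      change x i + m.val i x * u.toAdd.1 i x - x i = y i + m.val i y * u.toAdd.1 i y - y i
      linear_combination h1⟩
  map_one' := P_ext fun x i => by
    change x i + m.val i x * 0 = x i
    rw [mul_zero, add_zero]
  map_mul' u v := P_ext fun x i => congrFun (m.map_map u.toAdd.2 x).symm i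

/-- The element of `P_n` that adds `χ_i u_i` to each coordinate `i`. -/
def elt (u : LevelFun p n j) : P p n := m.hom (Multiplicative.ofAdd u)

theorem elt_apply (u : LevelFun p n j) (x : Fin n → ZMod p) (i : Fin n) :
    (m.elt u).1 x i = x i + m.val i x * u.1 i x := rfl

theorem elt_mem_range (u : LevelFun p n j) : m.elt u ∈ m.hom.range := ⟨_, rfl⟩

theorem exists_elt {g : P p n} (hg : g ∈ m.hom.range) : ∃ u, m.elt u = g := hg

theorem elt_mem_T (u : LevelFun p n j) : m.elt u ∈ T p n j := m.agree_map u.1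

theorem range_le_T : m.hom.range ≤ T p n j := by
  rintro _ ⟨u, rfl⟩
  exact m.elt_mem_T u.toAdd

theorem fiberSum_elt (i : Fin n) (u : LevelFun p n j) (y : Fin n → ZMod p) :
    fiberSum j i (m.elt u) y = m.weight i * u.1 i y := by
  rw [← m.sum_val i y, Finset.sum_mul]
  refine Finset.sum_congr rfl fun x hx => ?_
  rw [elt_apply, u.2 i x y (mem_fiber.1 hx).1]
  ring

end Mask

end SylowMaschke

namespace SylowMaschke

section Eta

variable {p n : ℕ}

theorem eta_apply (r : (ZMod p)ˣ) (k : Fin n) (x : Fin n → ZMod p) (i : Fin n) :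
    eta r k x i = (if i = k then (r : ZMod p) else 1) * x i := by
  change Function.update x k (r * x k) i = _
  by_cases h : i = k
  · subst h; simp
  · simp [h]

theorem eta_inv (r : (ZMod p)ˣ) (k : Fin n) : (eta r k)⁻¹ = eta r⁻¹ k := Equiv.ext fun _ => rfl

theorem eta_inv_apply (r : (ZMod p)ˣ) (k : Fin n) (x : Fin n → ZMod p) (i : Fin n) :
    (if i = k then (r : ZMod p) else 1) * eta r⁻¹ k x i = x i := by
  rw [eta_apply]
  by_cases h : i = k <;> simp [h]

theorem Agree.eta {j : ℕ} {x y : Fin n → ZMod p} (h : Agree j x y) (r : (ZMod p)ˣ) (k : Fin n) :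
    Agree j (eta r k x) (eta r k y) := fun i hi => by
  rw [eta_apply, eta_apply, h i hi]

theorem conj_eta_apply (r : (ZMod p)ˣ) (k : Fin n) (g : Equiv.Perm (Fin n → ZMod p))
    (x : Fin n → ZMod p) (i : Fin n) : (eta r k * g * (eta r k)⁻¹) x i =
      (if i = k then (r : ZMod p) else 1) * g (eta r⁻¹ k x) i := by
  rw [Equiv.Perm.mul_apply, Equiv.Perm.mul_apply, eta_inv, eta_apply]

theorem exists_mem_PSub_conj_eta [NeZero p] (r : (ZMod p)ˣ) (k : Fin n) {j : ℕ} {q : P p n}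
    (hq : q ∈ PSub p n j) : ∃ q' ∈ PSub p n j, eta r k * q.1 * (eta r k)⁻¹ = q'.1 := by
  have hP : eta r k * q.1 * (eta r k)⁻¹ ∈ P p n := by
    rw [mem_P_iff]
    intro i x y hxy
    have h := triangular_of_mem q i _ _ (hxy.eta r⁻¹ k)
    have hx := eta_inv_apply r k x i
    have hy := eta_inv_apply r k y i
    rw [conj_eta_apply, conj_eta_apply]
    linear_combination (if i = k then (r : ZMod p) else 1) * h + hx - hy
  refine ⟨⟨_, hP⟩, mem_PSub_iff.2 fun x i hi => ?_, rfl⟩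
  have h := PSub_apply q hq (eta r⁻¹ k x) i hi
  change (eta r k * q.1 * (eta r k)⁻¹) x i = x i
  rw [conj_eta_apply, h, eta_inv_apply]

end Eta

namespace Mask

variable {p n j : ℕ} [NeZero p] (m : Mask p n j)

theorem conj_mem_range {q : P p n} (hq : q ∈ PSub p n j) {g : P p n} (hg : g ∈ m.hom.range) :
    q * g * q⁻¹ ∈ m.hom.range := by
  obtain ⟨u, rfl⟩ := m.exists_elt hg
  let u' : LevelFun p n j := ⟨fun i x => u.1 i (q⁻¹.1 x), fun i x y h =>
    u.2 i _ _ ((agree_apply_iff q⁻¹).2 h)⟩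
  convert m.elt_mem_range u'
  refine P_ext fun x k => ?_
  have hz : ∀ l : Fin n, j ≤ l → q⁻¹.1 x l = x l := PSub_apply q⁻¹ (inv_mem hq) x
  rw [mul_apply, mul_apply]
  rcases lt_or_ge (k : ℕ) j with hk | hk
  · have h1 := (agree_apply_iff q).2 (m.elt_mem_T u (q⁻¹.1 x)) k hk
    rw [h1, apply_inv_apply, m.elt_mem_T u' x k hk]
  · rw [PSub_apply q hq _ k hk, elt_apply, elt_apply, hz k hk, m.congr_of_ge k _ _ hz]

theorem conj_eta_mem_range (r : (ZMod p)ˣ) (k : Fin n) {g : P p n} (hg : g ∈ m.hom.range) :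
    ∃ g' ∈ m.hom.range, eta r k * g.1 * (eta r k)⁻¹ = g'.1 := by
  obtain ⟨u, rfl⟩ := m.exists_elt hg
  let u' : LevelFun p n j := ⟨fun i x => (if i = k then (r : ZMod p) else 1) *
    u.1 i (eta r⁻¹ k x), fun i x y h => congrArg _ (u.2 i _ _ (h.eta r⁻¹ k))⟩
  refine ⟨_, m.elt_mem_range u', Equiv.ext fun x => funext fun i => ?_⟩
  have hx := eta_inv_apply r k x i
  have hu' : u'.1 i x = (if i = k then (r : ZMod p) else 1) * u.1 i (eta r⁻¹ k x) := rfl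
  rw [conj_eta_apply, elt_apply, elt_apply, m.val_eta, hu']
  linear_combination hx

/-- The subgroup generated by `P_j` and the elements `elt u`. -/
def complement : Subgroup (P p n) where
  carrier := {g | ∃ d ∈ m.hom.range, ∃ q ∈ PSub p n j, g = d * q}
  one_mem' := ⟨1, one_mem _, 1, one_mem _, (one_mul 1).symm⟩
  mul_mem' := by
    rintro _ _ ⟨d, hd, q, hq, rfl⟩ ⟨d', hd', q', hq', rfl⟩
    exact ⟨d * (q * d' * q⁻¹), mul_mem hd (m.conj_mem_range hq hd'), q * q', mul_mem hq hq',
      by group⟩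
  inv_mem' := by
    rintro _ ⟨d, hd, q, hq, rfl⟩
    exact ⟨q⁻¹ * d⁻¹ * q⁻¹⁻¹, m.conj_mem_range (inv_mem hq) (inv_mem hd), q⁻¹, inv_mem hq,
      by group⟩

theorem isHInvariant_complement (r : (ZMod p)ˣ) : IsHInvariant r m.complement := by
  have key : ∀ (r : (ZMod p)ˣ) (k : Fin n), ∀ c ∈ m.complement.map (P p n).subtype,
      eta r k * c * (eta r k)⁻¹ ∈ m.complement.map (P p n).subtype := by
    rintro r k _ ⟨_, ⟨d, hd, q, hq, rfl⟩, rfl⟩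
    obtain ⟨d', hd', ed⟩ := m.conj_eta_mem_range r k hd
    obtain ⟨q', hq', eq⟩ := exists_mem_PSub_conj_eta r k hq
    refine ⟨d' * q', ⟨d', hd', q', hq', rfl⟩, ?_⟩
    change d'.1 * q'.1 = eta r k * (d.1 * q.1) * (eta r k)⁻¹
    rw [← ed, ← eq]
    group
  have hle : H n r ≤ Subgroup.normalizer (m.complement.map (P p n).subtype) := by
    rw [H, Subgroup.closure_le]
    rintro _ ⟨k, rfl⟩
    rw [SetLike.mem_coe, Subgroup.mem_normalizer_iff]
    refine fun c => ⟨key r k c, fun hc => ?_⟩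
    have h := key r⁻¹ k _ hc
    rw [← eta_inv] at h
    convert h using 1
    group
  exact fun h hh c hc => (Subgroup.mem_normalizer_iff.1 (hle hh) c).1 hc

end Mask

variable {p n j : ℕ} [Fact p.Prime]

theorem Mask.elt_eq_one (m : Mask p n j) {u : LevelFun p n j}
    (h : ∀ i y, fiberSum j i (m.elt u) y = 0) : m.elt u = 1 := by
  refine P_ext fun x i => ?_
  rw [m.elt_apply]
  have h1 := h i x
  rw [m.fiberSum_elt] at h1
  rcases mul_eq_zero.1 h1 with h2 | h2
  · rw [m.val_eq_zero i x h2, zero_mul, add_zero]; rfl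
  · rw [h2, mul_zero, add_zero]; rfl

/-- If the coordinates in the support of a mask form a complement to the image of `N` in
`P_n / P_n'`, then the subgroup given by the mask is a complement to `N` in `P_n`. -/
theorem Mask.isComplement'_complement (m : Mask p n j) {N : Subgroup (P p n)} [N.Normal]
    (hNT : N ≤ T p n j) (hK : ⁅T p n j, T p n j⁆ ≤ N)
    (hsummand : ∃ D : Submodule (ZMod p) (TBar p n j), (∀ x, ∀ v ∈ D, rep p n j x v ∈ D) ∧
      IsCompl (clsSubmodule j N) D)
    (hinf : ∀ a ∈ N, (∀ i, m.weight i = 0 → fiberSum 0 i a 0 = 0) → ∀ i, fiberSum 0 i a 0 = 0)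
    (hsup : ∀ c : Fin n → ZMod p, (∀ a ∈ N, ∑ i, c i * fiberSum 0 i a 0 = 0) →
      (∀ i, m.weight i ≠ 0 → c i = 0) → ∀ i : Fin n, j ≤ i → c i = 0) :
    Subgroup.IsComplement' N m.complement := by
  obtain ⟨D, hD, hND⟩ := hsummand
  have hNst : ∀ x, ∀ v ∈ clsSubmodule j N, rep p n j x v ∈ clsSubmodule j N :=
    (NBar p n j N).apply_mem_toSubmodule
  have hIst : ∀ x, ∀ v ∈ clsSubmodule j m.hom.range,
      rep p n j x v ∈ clsSubmodule j m.hom.range := by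
    intro x v hv
    obtain ⟨t, ht, hm, rfl⟩ := mem_clsSubmodule.1 hv
    exact mem_clsSubmodule.2 ⟨_, _, m.conj_mem_range x.2 hm, (rep_cls x ht).symm⟩
  have hbot : clsSubmodule j N ⊓ clsSubmodule j m.hom.range = ⊥ := by
    by_contra hne
    obtain ⟨v, ⟨hvN, hvI⟩, hv0, hfix⟩ := exists_fixed_ne_zero
      (isPGroup_P.to_subgroup (PSub p n j)) (rep p n j) _
      (fun x v hv => Submodule.mem_inf.2 ⟨hNst x v hv.1, hIst x v hv.2⟩) hne
    obtain ⟨a, ha, hav⟩ := exists_total_eq_coord_of_fixed hNst hD hND hvN hfix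
    obtain ⟨g, hg, hgN, rfl⟩ := mem_clsSubmodule.1 ha
    obtain ⟨t, ht, hm, rfl⟩ := mem_clsSubmodule.1 hvI
    obtain ⟨u, rfl⟩ := m.exists_elt hm
    have h0 := hinf g hgN fun i hi => by
      rw [← total_cls i hg, hav i 0, coord_cls, m.fiberSum_elt, hi, zero_mul]
    refine hv0 (coord_injective fun i y => ?_)
    rw [← hav i y, total_cls, h0]
  have htop : clsSubmodule j N ⊔ clsSubmodule j m.hom.range = ⊤ := by
    refine eq_top_of_total (fun x v hv => ?_) fun c hc => hsup c (fun a ha => ?_) fun i hi => ?_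
    · obtain ⟨a, ha, b, hb, rfl⟩ := Submodule.mem_sup.1 hv
      rw [map_add]
      exact add_mem (Submodule.mem_sup_left (hNst x a ha)) (Submodule.mem_sup_right (hIst x b hb))
    · have h := hc _ (Submodule.mem_sup_left (mem_clsSubmodule.2 ⟨a, hNT ha, ha, rfl⟩))
      simpa only [total_cls] using h
    · let u : LevelFun p n j := ⟨fun k x => if k = i ∧ Agree j x 0 then 1 else 0,
        fun k x y h => if_congr (and_congr_right fun _ => ⟨h.symm.trans, h.trans⟩) rfl rfl⟩
      have htot : ∀ k, total j k (cls _ (m.elt_mem_T u)) = if k = i then m.weight i else 0 := by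
        intro k
        have hu : ∀ y, u.1 k y = if k = i ∧ Agree j y 0 then 1 else 0 := fun _ => rfl
        simp only [total, LinearMap.sum_apply, coord_cls, m.fiberSum_elt, hu]
        by_cases hk : k = i
        · subst hk
          rw [Finset.sum_eq_single 0]
          · simp [Agree.refl]
          · intro y hy hne
            rw [if_neg, mul_zero]
            rintro ⟨-, h⟩
            refine hne (funext fun l => ?_)
            rcases lt_or_ge (l : ℕ) j with hl | hl
            · exact h l hl
            · exact (mem_fiber.1 hy).2 l hl
          · intro h
            exact absurd (mem_fiber.2 ⟨Agree.refl _ _, fun _ _ => rfl⟩) h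
        · simp [hk]
      have h := hc _ (Submodule.mem_sup_right
        (mem_clsSubmodule.2 ⟨_, m.elt_mem_T u, m.elt_mem_range u, rfl⟩))
      simp only [htot, mul_ite, mul_zero, Finset.sum_ite_eq', Finset.mem_univ, if_true] at h
      exact (mul_eq_zero.1 h).resolve_right hi
  have hdisj : ∀ d ∈ m.hom.range, d ∈ N → d = 1 := by
    intro d hd hdN
    have hdT := hNT hdN
    have h0 : cls d hdT = 0 := by
      rw [← Submodule.mem_bot (ZMod p), ← hbot]
      exact ⟨mem_clsSubmodule.2 ⟨d, hdT, hdN, rfl⟩, mem_clsSubmodule.2 ⟨d, hdT, hd, rfl⟩⟩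
    obtain ⟨u, rfl⟩ := m.exists_elt hd
    refine m.elt_eq_one fun i y => ?_
    rw [← coord_cls i y hdT, h0, map_zero]
  refine Subgroup.isComplement'_of_disjoint_and_mul_eq_univ ?_ ?_
  · rw [Subgroup.disjoint_def]
    rintro _ hN ⟨d, hd, q, hq, rfl⟩
    have hq1 : q = 1 := by
      refine eq_one_of_mem_T_of_fix ?_ (PSub_apply q hq)
      have := mul_mem (inv_mem (m.range_le_T hd)) (hNT hN)
      rwa [inv_mul_cancel_left] at this
    subst hq1
    rw [mul_one] at hN ⊢
    exact hdisj d hd hN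
  · rw [Set.eq_univ_iff_forall]
    intro g
    obtain ⟨t, ht, q, hq, rfl⟩ := exists_T_mul_PSub j g
    obtain ⟨_, ha, _, hb, hab⟩ := Submodule.mem_sup.1
      ((htop ▸ Submodule.mem_top : cls t ht ∈ clsSubmodule j N ⊔ clsSubmodule j m.hom.range))
    obtain ⟨a, haT, haN, rfl⟩ := mem_clsSubmodule.1 ha
    obtain ⟨d, hdT, hd, rfl⟩ := mem_clsSubmodule.1 hb
    rw [← cls_mul haT hdT, cls_eq_cls_iff] at hab
    refine Set.mem_mul.2 ⟨t * d⁻¹, ?_, d * q, ⟨d, hd, q, hq, rfl⟩, by group⟩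
    have h1 := mul_mem haN (Subgroup.Normal.conj_mem inferInstance _ (hK hab) d)
    have h2 : a * (d * ((a * d)⁻¹ * t) * d⁻¹) = t * d⁻¹ := by group
    rwa [h2] at h1

end SylowMaschke

namespace SylowMaschke

variable {p n : ℕ} [Fact p.Prime]

/-- The mask that is supported on the coordinate `i₀`. -/
def singleMask (i₀ : Fin n) : Mask p n i₀ where
  val i _ := if i = i₀ then 1 else 0
  weight i := if i = i₀ then 1 else 0
  congr _ _ _ _ := rfl
  congr_of_ge _ _ _ _ := rfl
  eq_of_ne_zero i k _ hi hk := by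
    rw [ne_eq, ite_eq_right_iff, Classical.not_imp] at hi hk
    exact hi.1.trans hk.1.symm
  le_of_ne_zero i _ hi := by
    rw [ne_eq, ite_eq_right_iff, Classical.not_imp] at hi
    rw [hi.1]
  val_eta _ _ _ _ := rfl
  sum_val i y := by
    by_cases h : i = i₀
    · subst h
      have : fiber i i y = {trunc i y} := by
        ext x
        rw [mem_fiber, Finset.mem_singleton]
        refine ⟨fun h => eq_trunc h.1 h.2, ?_⟩
        rintro rfl
        exact ⟨trunc_agree _ _, fun k hk => trunc_of_le _ hk⟩
      simp [this]
    · simp [h]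
  val_eq_zero _ _ h := h

/-- The points whose coordinate before the `i`-th one is nonzero, while the coordinates from the
`j`-th one up to that one vanish. -/
def IsPivot (j : ℕ) (i : Fin n) (x : Fin n → ZMod p) : Prop :=
  ∀ k : Fin n, j ≤ k → (k : ℕ) < i → (x k = 0 ↔ (k : ℕ) + 1 ≠ i)

instance (j : ℕ) (i : Fin n) (x : Fin n → ZMod p) : Decidable (IsPivot j i x) := by
  unfold IsPivot
  infer_instance

theorem sum_isPivot {j : ℕ} {i : Fin n} (hi : j < i) (y : Fin n → ZMod p) :
    ∑ x ∈ fiber j i y, (if IsPivot j i x then (1 : ZMod p) else 0) = -1 := by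
  let k : Fin n := ⟨i - 1, by omega⟩
  have hk : (k : ℕ) + 1 = i := by change (i : ℕ) - 1 + 1 = i; omega
  have hset : (fiber j i y).filter (IsPivot j i) =
      ((Finset.univ : Finset (ZMod p)).erase 0).image (Function.update (trunc j y) k) := by
    ext x
    rw [Finset.mem_filter, mem_fiber, Finset.mem_image]
    constructor
    · rintro ⟨⟨h1, h2⟩, h3⟩
      refine ⟨x k, Finset.mem_erase.2 ⟨fun h => (h3 k (by omega) (by omega)).1 h hk,
        Finset.mem_univ _⟩, ?_⟩
      funext l
      by_cases hl : l = k
      · subst hl; simp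
      · have hlk : (l : ℕ) ≠ k := fun h => hl (Fin.ext h)
        rw [Function.update_of_ne hl]
        rcases lt_or_ge (l : ℕ) j with hlj | hlj
        · rw [trunc_agree j y l hlj, h1 l hlj]
        · rw [trunc_of_le y hlj]
          rcases lt_or_ge (l : ℕ) i with hli | hli
          · exact ((h3 l hlj hli).2 (by omega)).symm
          · exact (h2 l hli).symm
    · rintro ⟨s, hs, rfl⟩
      have hne : ∀ l : Fin n, (l : ℕ) ≠ k → Function.update (trunc j y) k s l = trunc j y l :=
        fun l hl => Function.update_of_ne (fun h => hl (congrArg _ h)) _ _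
      refine ⟨⟨fun l hl => ?_, fun l hl => ?_⟩, fun l hjl hl => ?_⟩
      · rw [hne l (by omega), trunc_agree j y l hl]
      · rw [hne l (by omega), trunc_of_le y (by omega)]
      · by_cases hlk : (l : ℕ) = k
        · obtain rfl : l = k := Fin.ext hlk
          rw [Function.update_self]
          exact ⟨fun h => absurd h (Finset.mem_erase.1 hs).1, fun h => absurd hk h⟩
        · rw [hne l hlk, trunc_of_le y hjl]
          exact ⟨fun _ => by omega, fun _ => rfl⟩
  rw [Finset.sum_ite, Finset.sum_const_zero, add_zero, hset, Finset.sum_const,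
    Finset.card_image_of_injective _ (Function.update_injective _ _),
    Finset.card_erase_of_mem (Finset.mem_univ _), Finset.card_univ, ZMod.card, nsmul_eq_mul,
    Nat.cast_sub (Fact.out : p.Prime).one_le, ZMod.natCast_self]
  simp

open Classical in
/-- The mask that is supported on the coordinates in a set of indices greater than `j`. -/
noncomputable def pivotMask (j : ℕ) (I : Set (Fin n)) (hI : ∀ i ∈ I, j < i) : Mask p n j where
  val i x := if i ∈ I ∧ IsPivot j i x then 1 else 0
  weight i := if i ∈ I then -1 else 0
  congr i x y h := if_congr (and_congr_right fun _ =>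
    forall_congr' fun k => forall₂_congr fun _ hk => by rw [h k hk]) rfl rfl
  congr_of_ge i x y h := if_congr (and_congr_right fun _ =>
    forall_congr' fun k => forall₂_congr fun hk _ => by rw [h k hk]) rfl rfl
  eq_of_ne_zero i k x hi hk := by
    rw [ne_eq, ite_eq_right_iff, Classical.not_imp] at hi hk
    obtain ⟨⟨hiI, hi⟩, -⟩ := hi
    obtain ⟨⟨hkI, hk⟩, -⟩ := hk
    have key : ∀ i k : Fin n, i ∈ I → k ∈ I → IsPivot j i x → IsPivot j k x → ¬ i < k := by
      intro i k hiI hkI hi hk hlt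
      have h1 := hI i hiI
      have h2 := Fin.lt_def.1 hlt
      let l : Fin n := ⟨i - 1, by omega⟩
      have hl : (l : ℕ) + 1 = i := by change (i : ℕ) - 1 + 1 = i; omega
      have h3 := (hk l (by omega) (by omega)).2 (by omega)
      exact (hi l (by omega) (by omega)).1 h3 hl
    exact le_antisymm (not_lt.1 (key k i hkI hiI hk hi)) (not_lt.1 (key i k hiI hkI hi hk))
  le_of_ne_zero i x hi := by
    rw [ne_eq, ite_eq_right_iff, Classical.not_imp] at hi
    exact (hI i hi.1.1).le
  val_eta r k i x := if_congr (and_congr_right fun _ =>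
    forall_congr' fun l => forall₂_congr fun _ _ => by
      rw [eta_apply]
      by_cases h : l = k <;> simp [h]) rfl rfl
  sum_val i y := by
    by_cases h : i ∈ I
    · rw [if_pos h, ← sum_isPivot (hI i h) y]
      refine Finset.sum_congr rfl fun x _ => ?_
      by_cases h' : IsPivot j i x <;> simp [h, h']
    · simp [h]
  val_eq_zero i x h := by
    by_cases hi : i ∈ I
    · rw [if_pos hi, neg_eq_zero] at h
      exact absurd h one_ne_zero
    · simp [hi]

/-- The image of `N` in `P_n / P_n' ≅ 𝔽_p^n`. -/
def totals (N : Subgroup (P p n)) : Submodule (ZMod p) (Fin n → ZMod p) :=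
  AddSubgroup.toZModSubmodule p
    { carrier := {c | ∃ a ∈ N, ∀ i, fiberSum 0 i a 0 = c i}
      zero_mem' := ⟨1, one_mem N, fun i => by simp [fiberSum]⟩
      add_mem' := by
        rintro c d ⟨a, ha, hc⟩ ⟨b, hb, hd⟩
        exact ⟨a * b, mul_mem ha hb, fun i => by
          rw [fiberSum_zero_mul, hc, hd, Pi.add_apply]⟩
      neg_mem' := by
        rintro c ⟨a, ha, hc⟩
        refine ⟨a⁻¹, inv_mem ha, fun i => ?_⟩
        have h1 := fiberSum_zero_mul i a⁻¹ a
        have h2 : fiberSum 0 i (1 : P p n) 0 = 0 := by simp [fiberSum]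
        rw [inv_mul_cancel, h2, hc] at h1
        rw [Pi.neg_apply]
        linear_combination -h1 }

theorem exists_mask (i₀ : Fin n) {N : Subgroup (P p n)} (hNT : N ≤ T p n i₀)
    (hN : ¬ (N.map (QuotientGroup.mk' (commutator (P p n))) <
      (T p n (i₀ + 1)).map (QuotientGroup.mk' (commutator (P p n))))) :
    ∃ m : Mask p n i₀,
      (∀ a ∈ N, (∀ i, m.weight i = 0 → fiberSum 0 i a 0 = 0) → ∀ i, fiberSum 0 i a 0 = 0) ∧
      ∀ c : Fin n → ZMod p, (∀ a ∈ N, ∑ i, c i * fiberSum 0 i a 0 = 0) →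
        (∀ i, m.weight i ≠ 0 → c i = 0) → ∀ i, i₀ ≤ i → c i = 0 := by
  by_cases hcase : ∀ a ∈ N, fiberSum 0 i₀ a 0 = 0
  · refine ⟨singleMask i₀, fun a ha h i => ?_, fun c hc hw i hi => ?_⟩
    · by_cases hi : i = i₀
      · rw [hi, hcase a ha]
      · exact h i (if_neg hi)
    · rcases hi.lt_or_eq with hi | rfl
      · have hle : N.map (QuotientGroup.mk' (commutator (P p n))) ≤
            (T p n (i₀ + 1)).map (QuotientGroup.mk' (commutator (P p n))) := by
          rintro _ ⟨a, ha, rfl⟩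
          obtain ⟨v, hv⟩ := exists_total_eq (p := p) (i₀ + 1) (fun i => fiberSum 0 i a 0)
            fun i hi => by
              rcases lt_or_eq_of_le (Nat.lt_succ_iff.1 hi) with h | h
              · exact fiberSum_eq_zero h (hNT ha) _ _
              · rw [Fin.ext h, hcase a ha]
          obtain ⟨t, ht, rfl⟩ := exists_cls v
          exact mem_map_mk_commutator.2 ⟨t, ht, fun i => by rw [← hv i, total_cls]⟩
        have hge : (T p n (i₀ + 1)).map (QuotientGroup.mk' (commutator (P p n))) ≤
            N.map (QuotientGroup.mk' (commutator (P p n))) := by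
          by_contra h
          exact hN ⟨hle, h⟩
        obtain ⟨a, ha, h⟩ := mem_map_mk_commutator.1
          (hge ⟨_, sigmaP_mem_T i (Fin.lt_def.1 hi), rfl⟩)
        have h1 := hc a ha
        simpa [h, fiberSum_zero_sigma] using h1
      · refine hw i₀ ?_
        change (if i₀ = i₀ then (1 : ZMod p) else 0) ≠ 0
        rw [if_pos rfl]
        exact one_ne_zero
  · push Not at hcase
    obtain ⟨g, hg, hg0⟩ := hcase
    let v : Fin n → (Fin n → ZMod p) ⧸ totals N := fun i => (totals N).mkQ (Pi.single i 1)
    obtain ⟨I, hIt, -, hspan, hli⟩ := exists_linearIndepOn_extension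
      (linearIndepOn_empty (ZMod p) v) (Set.empty_subset {i | i₀ < i})
    have hI : ∀ i ∈ I, (i₀ : ℕ) < i := fun i hi => Fin.lt_def.1 (hIt hi)
    have hweight : ∀ i, (pivotMask (p := p) i₀ I hI).weight i ≠ 0 ↔ i ∈ I := by
      classical
      intro i
      change (if i ∈ I then (-1 : ZMod p) else 0) ≠ 0 ↔ _
      by_cases h : i ∈ I <;> simp [h]
    refine ⟨pivotMask i₀ I hI, fun a ha h => ?_, fun c hc hw i hi => ?_⟩
    · classical
      rw [linearIndepOn_iff'] at hli
      have hmem : (fun i => fiberSum 0 i a 0) ∈ totals N := ⟨a, ha, fun _ => rfl⟩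
      have hoff : ∀ i, i ∉ I → fiberSum 0 i a 0 = 0 := fun i hi => h i (by
        by_contra h'
        exact hi ((hweight i).1 h'))
      have hsum : ∑ i ∈ Finset.univ.filter (· ∈ I), fiberSum 0 i a 0 • v i = 0 := by
        have h1 : (totals N).mkQ (fun i => fiberSum 0 i a 0) = 0 :=
          (Submodule.Quotient.mk_eq_zero _).2 hmem
        rw [pi_eq_sum_univ' (fun i => fiberSum 0 i a 0), map_sum] at h1
        rw [← h1, Finset.sum_filter]
        refine Finset.sum_congr rfl fun i _ => ?_
        by_cases hi : i ∈ I
        · rw [if_pos hi, map_smul]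
        · rw [if_neg hi, hoff i hi, zero_smul, map_zero]
      intro i
      by_cases hi : i ∈ I
      · exact hli (Finset.univ.filter (· ∈ I)) _ (fun k hk => (Finset.mem_filter.1 hk).2) hsum i
          (Finset.mem_filter.2 ⟨Finset.mem_univ _, hi⟩)
      · exact hoff i hi
    · let φ : (Fin n → ZMod p) →ₗ[ZMod p] ZMod p := ∑ i, c i • LinearMap.proj i
      have hφ : ∀ d, φ d = ∑ i, c i * d i := fun d => by simp [φ]
      have hker : totals N ≤ LinearMap.ker φ := by
        rintro d ⟨a, ha, h⟩
        rw [LinearMap.mem_ker, hφ, ← hc a ha]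
        exact Finset.sum_congr rfl fun i _ => by rw [h]
      let ψ := (totals N).liftQ φ hker
      have hψ : ∀ i, ψ (v i) = c i := fun i => by
        change φ (Pi.single i 1) = c i
        rw [hφ]
        simp [Pi.single_apply]
      have hψI : Submodule.span (ZMod p) (v '' I) ≤ LinearMap.ker ψ := by
        rw [Submodule.span_le]
        rintro _ ⟨i, hi, rfl⟩
        exact (hψ i).trans (hw i ((hweight i).2 hi))
      have hgt : ∀ i, i₀ < i → c i = 0 := fun i hi => by
        rw [← hψ i]
        exact hψI (hspan ⟨i, hi, rfl⟩)
      rcases hi.lt_or_eq with hi | rfl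
      · exact hgt i hi
      · have h1 := hc g hg
        rw [Finset.sum_eq_single i₀] at h1
        · exact (mul_eq_zero.1 h1).resolve_right hg0
        · intro k _ hk
          rcases lt_or_gt_of_ne hk with hk | hk
          · rw [fiberSum_eq_zero (Fin.lt_def.1 hk) (hNT hg), mul_zero]
          · rw [hgt k hk, zero_mul]
        · intro h
          exact absurd (Finset.mem_univ _) h

end SylowMaschke

open SylowMaschke in
theorem proposition9p2 (p n : ℕ) [Fact p.Prime] (r : (ZMod p)ˣ)
    (hr : ∀ u : (ZMod p)ˣ, u ∈ Subgroup.zpowers r)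
    (N : Subgroup (P p n)) [N.Normal] (j : ℕ) (hj : HasDepth N j) :
    ⁅T p n j, T p n j⁆ ≤ N ∧
    List.TFAE [
      ∃ C : Subgroup (P p n), Subgroup.IsComplement' N C,
      ∃ C : Subgroup (P p n), Subgroup.IsComplement' N C ∧ IsHInvariant r C,
      (∃ D : Submodule (MonoidAlgebra (ZMod p) (PSub p n j)) (rep p n j).asModule,
          IsCompl (NBar p n j N).asSubmodule D) ∧
        ¬ (N.map (QuotientGroup.mk' (commutator (P p n))) <
            (T p n (j + 1)).map (QuotientGroup.mk' (commutator (P p n))))] := by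
  obtain ⟨⟨hjn, hNT⟩, hmax⟩ := hj
  rw [exists_isCompl_iff]
  rcases hjn.lt_or_eq with hlt | rfl
  · obtain ⟨i₀, rfl⟩ : ∃ i₀ : Fin n, (i₀ : ℕ) = j := ⟨⟨j, hlt⟩, rfl⟩
    have hnle : ¬ N ≤ T p n (i₀ + 1) := fun h => by
      have := hmax ⟨hlt, h⟩
      omega
    obtain ⟨g, hg, hgT⟩ := SetLike.not_le_iff_exists.1 hnle
    rw [mem_T] at hgT
    push Not at hgT
    obtain ⟨x, k, hk, hx⟩ := hgT
    have hk' : k = i₀ := by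
      by_contra hne
      have : (k : ℕ) ≠ i₀ := fun h => hne (Fin.ext h)
      exact hx (hNT hg x k (by omega))
    subst hk'
    have hK := commutator_T_le k rfl hNT hg hx
    refine ⟨hK, ?_⟩
    tfae_have 2 → 1 := fun ⟨C, hC, _⟩ => ⟨C, hC⟩
    tfae_have 1 → 3 := fun ⟨C, hC⟩ =>
      ⟨exists_isCompl_of_isComplement' hNT hK hC, not_map_lt_of_isComplement' k hNT hK hC⟩
    tfae_have 3 → 2 := by
      rintro ⟨hD, hN⟩
      obtain ⟨m, hinf, hsup⟩ := exists_mask k hNT hN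
      exact ⟨m.complement, m.isComplement'_complement hNT hK hD hinf hsup,
        m.isHInvariant_complement r⟩
    tfae_finish
  · obtain rfl : N = ⊥ := by
      rw [T_self] at hNT
      exact le_bot_iff.1 hNT
    have hK : ⁅T p j j, T p j j⁆ ≤ ⊥ := by
      rw [T_self, Subgroup.commutator_bot_left]
    refine ⟨hK, ?_⟩
    tfae_have 2 → 1 := fun ⟨C, hC, _⟩ => ⟨C, hC⟩
    tfae_have 1 → 3 := fun ⟨C, hC⟩ => by
      refine ⟨exists_isCompl_of_isComplement' hNT hK hC, fun h => h.not_ge ?_⟩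
      rintro _ ⟨t, ht, rfl⟩
      have : t = 1 := P_ext fun x k => ht x k (by omega)
      rw [this, map_one]
      exact one_mem _
    tfae_have 3 → 2 := by
      rintro ⟨hD, -⟩
      let m : Mask p j j := pivotMask j ∅ fun _ h => absurd h (Set.notMem_empty _)
      refine ⟨m.complement, m.isComplement'_complement hNT hK hD (fun a ha _ i => ?_)
        fun c _ _ i hi => absurd i.2 (not_lt.2 hi), m.isHInvariant_complement r⟩
      rw [Subgroup.mem_bot.1 ha]
      simp [fiberSum]
    tfae_finish
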